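/- Let $d\ge 1$ be an integer, let $|n|$ denote the Euclidean norm of $n\in\mathbb{Z}^d$, and let $\delta_1,\dots,\delta_d$ be the standard basis vectors. For $V:\mathbb{Z}^d\to\mathbb{R}$ let $H_V=-\Delta+V$ be the discrete Schrödinger operator in $\ell^2(\mathbb{Z}^d)$, where $$(-\Delta\psi)_n=\sum_{m\in\mathbb{Z}^d,\ |m-n|=1}(\psi_n-\psi_m),$$ and $V$ acts by multiplication, $(V\psi)_n=V_n\psi_n$, on its maximal domain $\{\psi\in\ell^2(\mathbb{Z}^d): V\psi\in\ell^2(\mathbb{Z}^d)\}$; this is also the domain of $H_V$, and $H_V$ is self-adjoint. Write $\sigma$, $\sigma_{\rm ess}$ and $\sigma_{\rm p}$ for the spectrum, the essential spectrum and the set of eigenvalues, respectively. If $H_V$ is bounded from above and $s_+=\sup\sigma(H_V)$, then $H_V$ is called critical at $s_+$ from above if, for every $W:\mathbb{Z}^d\to[0,\infty)$ whose multiplication operator is compact, $\sup\sigma(H_V+W)=s_+$ implies $W=0$. Put $\log_0x=x$ and $\log_{k+1}x=\log(\log_kx)$ for $k\ge 0$; empty sums are $0$ and empty products are $1$. Suppose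 that $\sup\sigma(H_V)=\sup\sigma_{\rm ess}(H_V)=4d$ and that $H_V$ is critical at $4d$ from above. (i) If there exist an integer $s\ge 0$ and $\varepsilon>0$ such that $$\begin{aligned}V_n\le 2d&-\sum_{j=1}^d\left(\frac{|n|}{|n+\delta_j|}\right)^{d/2}\left(\prod_{i=1}^s\sqrt{\frac{\log_i|n|}{\log_i|n+\delta_j|}}\right)\left(\frac{\log_s|n|}{\log_s|n+\delta_j|}\right)^{\varepsilon}\\&-\sum_{j=1}^d\left(\frac{|n|}{|n-\delta_j|}\right)^{d/2}\left(\prod_{i=1}^s\sqrt{\frac{\log_i|n|}{\log_i|n-\delta_j|}}\right)\left(\frac{\log_s|n|}{\log_s|n-\delta_j|}\right)^{\varepsilon}\end{aligned}$$ for all $n\in\mathbb{Z}^d$ with $|n|$ sufficiently large, then $4d\in\sigma_{\rm p}(H_V)$. (ii) In particular, if there exist an integer $s\ge 0$ and $\varepsilon>0$ such that $$V_n\le-\frac{d(4-d)}{4|n|^2}-\frac{1}{|n|^2}\sum_{j=1}^s\prod_{k=1}^j\frac{1}{\log_k|n|}-\frac{\varepsilon}{|n|^2}\prod_{k=1}^s\frac{1}{\log_k|n|}$$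 for all $n\in\mathbb{Z}^d$ with $|n|$ sufficiently large, then $4d\in\sigma_{\rm p}(H_V)$. -/

import Mathlib

namespace DiscreteSchrodinger

noncomputable section

/-! ### Spectra of partially defined operators on a Hilbert space -/

section Spectra

variable {H : Type*} [NormedAddCommGroup H] [InnerProductSpace ℂ H]

/-- The resolvent set of a (possibly unbounded) operator `A`: those `z` for which
`A - z : Dom A → H` is a bijection with a bounded inverse `R`. -/
def resolventSet (A : H →ₗ.[ℂ] H) : Set ℂ :=
  {z | ∃ R : H →L[ℂ] H,
    (∀ x : A.domain, R (A x - z • (x : H)) = x) ∧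
    ∀ y : H, ∃ x : A.domain, (x : H) = R y ∧ A x - z • (x : H) = y}

/-- The spectrum of an operator. -/
def spec (A : H →ₗ.[ℂ] H) : Set ℂ := (resolventSet A)ᶜ

/-- The eigenspace `ker (A - z)`, as a subspace of the Hilbert space. -/
def eigenspace (A : H →ₗ.[ℂ] H) (z : ℂ) : Submodule ℂ H :=
  (LinearMap.ker (A.toFun - z • A.domain.subtype)).map A.domain.subtype

/-- The point spectrum: the set of eigenvalues. -/
def pointSpec (A : H →ₗ.[ℂ] H) : Set ℂ :=
  {z | ∃ x : A.domain, (x : H) ≠ 0 ∧ A x = z • (x : H)}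

/-- The discrete spectrum: the eigenvalues of finite multiplicity that are isolated points of the
spectrum. -/
def discreteSpec (A : H →ₗ.[ℂ] H) : Set ℂ :=
  {z | z ∈ pointSpec A ∧ FiniteDimensional ℂ (eigenspace A z) ∧
    ∃ r : ℝ, 0 < r ∧ ∀ w ∈ spec A, dist w z < r → w = z}

/-- The essential spectrum of a self-adjoint operator: the complement of the discrete spectrum in
the spectrum. -/
def essSpec (A : H →ₗ.[ℂ] H) : Set ℂ := spec A \ discreteSpec A

/-- The real points of a set of complex numbers. The spectrum of a self-adjoint operator is real,
so nothing is lost; its supremum is taken in `ℝ`. -/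
def realPoints (S : Set ℂ) : Set ℝ := {x : ℝ | (x : ℂ) ∈ S}

end Spectra

/-! ### The discrete Laplacian and discrete Schrödinger operators -/

/-- The lattice `ℤ^d`. -/
abbrev Lattice (d : ℕ) : Type := Fin d → ℤ

/-- The `j`-th standard basis vector `δ_j`. -/
def basisVec {d : ℕ} (j : Fin d) : Lattice d := Pi.single j 1

/-- The Euclidean norm of a lattice point. -/
def latNorm {d : ℕ} (n : Lattice d) : ℝ := Real.sqrt (∑ j, (n j : ℝ) ^ 2)

/-- The Hilbert space `ℓ²(ℤ^d)` of complex-valued square-summable functions. -/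
abbrev ell2 (d : ℕ) : Type := lp (fun _ : Lattice d => ℂ) 2

theorem memℓp_shift {d : ℕ} (a : Lattice d) {f : Lattice d → ℂ} (hf : Memℓp f 2) :
    Memℓp (fun n => f (n + a)) 2 := by
  rw [memℓp_gen_iff (by norm_num)] at hf ⊢
  exact hf.comp_injective (add_left_injective a)

/-- The pointwise negative discrete Laplacian: the sum of `ψ n - ψ m` over the `2d` nearest
neighbours `m = n ± δ_j` of `n`, which are the lattice points at Euclidean distance `1`. -/
def negLaplacianFun {d : ℕ} (ψ : Lattice d → ℂ) (n : Lattice d) : ℂ :=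
  ∑ j : Fin d, ((ψ n - ψ (n + basisVec j)) + (ψ n - ψ (n - basisVec j)))

theorem memℓp_negLaplacianFun {d : ℕ} {f : Lattice d → ℂ} (hf : Memℓp f 2) :
    Memℓp (negLaplacianFun f) 2 := by
  have key : ∀ j : Fin d, Memℓp
      (fun n => (f n - f (n + basisVec j)) + (f n - f (n - basisVec j))) 2 := by
    intro j
    have h1 := memℓp_shift (basisVec j) hf
    have h2 : Memℓp (fun n => f (n - basisVec j)) 2 := by
      simpa only [sub_eq_add_neg] using memℓp_shift (-basisVec j) hf
    exact (hf.sub h1).add (hf.sub h2)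
  exact Memℓp.finsetSum Finset.univ (fun j _ => key j)

/-- The negative discrete Laplacian `-Δ` on `ℓ²(ℤ^d)`. -/
def negLaplacian (d : ℕ) : ell2 d →ₗ[ℂ] ell2 d where
  toFun ψ := ⟨negLaplacianFun ψ, memℓp_negLaplacianFun (lp.memℓp ψ)⟩
  map_add' φ ψ := by
    ext n
    simp only [negLaplacianFun, lp.coeFn_add, Pi.add_apply]
    rw [← Finset.sum_add_distrib]
    exact Finset.sum_congr rfl fun j _ => by ring
  map_smul' c ψ := by
    ext n
    simp only [negLaplacianFun, lp.coeFn_smul, Pi.smul_apply, smul_eq_mul, RingHom.id_apply,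
      Finset.mul_sum]
    exact Finset.sum_congr rfl fun j _ => by ring

/-- The maximal domain of the operator of multiplication by `V`. -/
def potentialDomain {d : ℕ} (V : Lattice d → ℝ) : Submodule ℂ (ell2 d) where
  carrier := {ψ | Memℓp (fun n => (V n : ℂ) * ψ n) 2}
  zero_mem' := by
    have h : (fun n => (V n : ℂ) * (0 : ell2 d) n) = (0 : Lattice d → ℂ) := by
      funext n; simp
    change Memℓp _ 2
    rw [h]
    exact zero_memℓp
  add_mem' := by
    intro φ ψ hφ hψ
    have h : (fun n => (V n : ℂ) * (φ + ψ) n)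
        = (fun n => (V n : ℂ) * φ n) + (fun n => (V n : ℂ) * ψ n) := by
      funext n; simp [mul_add]
    change Memℓp _ 2
    rw [h]
    exact Memℓp.add hφ hψ
  smul_mem' := by
    intro c ψ hψ
    have h : (fun n => (V n : ℂ) * (c • ψ) n) = c • (fun n => (V n : ℂ) * ψ n) := by
      funext n; simp [mul_left_comm]
    change Memℓp _ 2
    rw [h]
    exact Memℓp.const_smul hψ c

/-- The operator of multiplication by a real function `V`, on its maximal domain. -/
def potential {d : ℕ} (V : Lattice d → ℝ) : ell2 d →ₗ.[ℂ] ell2 d where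
  domain := potentialDomain V
  toFun :=
    { toFun := fun ψ => ⟨fun n => (V n : ℂ) * (ψ : ell2 d) n, ψ.2⟩
      map_add' := by
        intro φ ψ
        ext n
        exact mul_add _ _ _
      map_smul' := by
        intro c ψ
        ext n
        exact mul_left_comm _ _ _ }

/-- The discrete Schrödinger operator `H_V = -Δ + V`, the operator sum, with domain `Dom V`. -/
def schrodinger {d : ℕ} (V : Lattice d → ℝ) : ell2 d →ₗ.[ℂ] ell2 d :=
  (negLaplacian d).toPMap ⊤ + potential V

/-- Multiplication by `W` is an everywhere defined compact operator on `ℓ²(ℤ^d)`. -/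
def IsCompactPotential {d : ℕ} (W : Lattice d → ℝ) : Prop :=
  ∃ T : ell2 d →L[ℂ] ell2 d, IsCompactOperator T ∧
    ∀ (ψ : ell2 d) (n : Lattice d), T ψ n = (W n : ℂ) * ψ n

/-- `H_V` is bounded from above with `sup σ(H_V) = E`, and it is critical at `E` from above: the
only compact potential `W ≥ 0` with `sup σ(H_V + W) = E` is `W = 0`. -/
def IsCriticalFromAbove {d : ℕ} (V : Lattice d → ℝ) (E : ℝ) : Prop :=
  IsLUB (realPoints (spec (schrodinger V))) E ∧
  ∀ W : Lattice d → ℝ, (∀ n, 0 ≤ W n) → IsCompactPotential W →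
    IsLUB (realPoints (spec (schrodinger V + potential W))) E → W = 0

/-! ### The comparison expressions -/

/-- The `k`-fold iterated natural logarithm, `logIter 0 x = x`. -/
def logIter (k : ℕ) (x : ℝ) : ℝ := Real.log^[k] x

/-- For lattice points `n` and `m`, the quotient
`(|n|/|m|)^{d/2} ∏_{i=1}^s (log_i |n| / log_i |m|)^{1/2} · (log_s |n| / log_s |m|)^ε`. -/
def comparisonTerm {d : ℕ} (s : ℕ) (ε : ℝ) (n m : Lattice d) : ℝ :=
  (latNorm n / latNorm m) ^ ((d : ℝ) / 2) *
    (∏ i ∈ Finset.Icc 1 s, Real.sqrt (logIter i (latNorm n) / logIter i (latNorm m))) *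
    (logIter s (latNorm n) / logIter s (latNorm m)) ^ ε

end

end DiscreteSchrodinger

/-! Conjugation by the sign `parity` turns `4d - H_V` into L = `flippedOp V`, which has nonpositive
off-diagonal entries, so maximum principles apply. Since `4d` bounds the spectrum from above, the
form of L is nonnegative on finitely supported functions; an ℓ² solution of Lφ = 0 with φ(0) = 1
yields the eigenvector `parity * φ` at `4d`.

Criticality enters through multiples of the point potential at the origin. If the form of L
dominated c f(0)² for some c > 0, the Sherman-Morrison formula would show that adding the point
potential c leaves the supremum of the spectrum at `4d`, which criticality forbids
(`exists_energy_lt_of_isCritical`). Hence suitable Green's functions of L + l at the origin, on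
finite sets exhausting the lattice and with l → 0, have values at the origin tending to infinity.
Normalised to 1 there, they solve the equation up to errors tending to 0
(`exists_approximate_groundState`). A Harnack bound gives a pointwise limit φ with Lφ = 0, and any
positive supersolution u near infinity dominates all late approximants, hence φ. If u is in ℓ², so
is φ (`mem_pointSpec_of_supersolution`).

For (i), take u to be the radial function `radialProfile` at |n|. Each comparison term is a quotient
of u at a neighbour and u at n, so the hypothesis on V says Lu ≥ 0 near infinity. Up to constants,
the sum of u² over a shell of radius r is the derivative of (log_s r)^(-2ε), whence
square-summability.

For (ii), expand each quotient in the relative increment x of |n|², that is x = (1 ± 2 n_j)/|n|².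
With W = `logWeight`, summation over neighbours gives (d(4-d)/4 + W + W²/4 + O((log |n|)^(-2)) +
O(|n|^(-2)))/|n|² for s ≥ 1. For a smaller exponent ε the errors fit under the last term of the
potential (`exists_logWeight_absorbed`), so (ii) follows from (i). `HasJet` keeps the remainders
uniform in the values 1/log_k |n|. -/

namespace DiscreteSchrodinger

open Filter Topology
open scoped InnerProductSpace

/-! ### Form bounds from the resolvent set -/

section Abstract

variable {H : Type*} [NormedAddCommGroup H] [InnerProductSpace ℂ H] [CompleteSpace H]

/-- A symmetric operator whose resolvent set contains the half-line `(E, ∞)` is bounded above by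
`E` in the sense of quadratic forms. -/
theorem re_inner_le_of_forall_mem_resolventSet (A : H →ₗ.[ℂ] H)
    (hA : ∀ x y : A.domain, ⟪A x, (y : H)⟫_ℂ = ⟪(x : H), A y⟫_ℂ) (E : ℝ)
    (h : ∀ l : ℝ, E < l → (l : ℂ) ∈ resolventSet A) (x : A.domain) :
    (⟪A x, (x : H)⟫_ℂ).re ≤ E * ‖(x : H)‖ ^ 2 := by
  suffices key : ∀ l : ℝ, E < l → (⟪A x, (x : H)⟫_ℂ).re ≤ l * ‖(x : H)‖ ^ 2 by
    have ht : Tendsto (fun l : ℝ => l * ‖(x : H)‖ ^ 2) (𝓝[>] E) (𝓝 (E * ‖(x : H)‖ ^ 2)) :=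
      ((continuous_id.mul continuous_const).tendsto E).mono_left nhdsWithin_le_nhds
    exact ge_of_tendsto ht (by filter_upwards [self_mem_nhdsWithin] with l hl using key l hl)
  intro l hl
  obtain ⟨R, hR1, hR2⟩ := h l hl
  have hsymm : (R : H →ₗ[ℂ] H).IsSymmetric := by
    intro u v
    obtain ⟨a, ha, rfl⟩ := hR2 u
    obtain ⟨b, hb, rfl⟩ := hR2 v
    change ⟪R _, _⟫_ℂ = ⟪_, R _⟫_ℂ
    rw [hR1, hR1, inner_sub_left, inner_sub_right, hA, inner_smul_left, inner_smul_right]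
    simp
  have hsa : IsSelfAdjoint R := ContinuousLinearMap.isSelfAdjoint_iff_isSymmetric.2 hsymm
  have hneg : 0 ≤ -R := by
    rw [StarOrderedRing.nonneg_iff_spectrum_nonneg (R := ℝ) (-R) hsa.neg]
    intro t ht
    by_contra htneg
    push Not at htneg
    apply ht
    set m : ℝ := -t with hm
    have hm0 : 0 < m := by linarith
    -- R is (A - l)⁻¹, so the value m of R corresponds to the value l + 1/m of A, which lies above E
    -- and is therefore in the resolvent set.
    obtain ⟨R₁, hS1, hS2⟩ := h (l + 1 / m) (by have := one_div_pos.2 hm0; linarith)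
    have hmc : (m : ℂ) ≠ 0 := by exact_mod_cast hm0.ne'
    -- the resolvent identities
    have hres : ∀ y, R y - R₁ y = -((1 / m : ℝ) : ℂ) • R (R₁ y) := by
      intro y
      obtain ⟨a, ha, rfl⟩ := hS2 y
      rw [hS1]
      have h1 := hR1 a
      have h2 : A a - ((l + 1 / m : ℝ) : ℂ) • (a : H)
          = (A a - (l : ℂ) • (a : H)) - ((1 / m : ℝ) : ℂ) • (a : H) := by
        push_cast; module
      rw [h2, map_sub, h1, map_smul]; module
    have hres' : ∀ y, R y - R₁ y = -((1 / m : ℝ) : ℂ) • R₁ (R y) := by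
      intro y
      obtain ⟨a, ha, rfl⟩ := hR2 y
      rw [hR1]
      have h1 := hS1 a
      have h2 : A a - (l : ℂ) • (a : H)
          = (A a - ((l + 1 / m : ℝ) : ℂ) • (a : H)) + ((1 / m : ℝ) : ℂ) • (a : H) := by
        push_cast; module
      rw [h2, map_add, h1, map_smul]; module
    have hinv : IsUnit (algebraMap ℝ (H →L[ℂ] H) t - -R) := by
      have halg : algebraMap ℝ (H →L[ℂ] H) t - -R
          = R - (m : ℂ) • (1 : H →L[ℂ] H) := by
        rw [Algebra.algebraMap_eq_smul_one]
        ext y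
        simp [hm]
        abel
      rw [halg]
      -- With x = a - l, (1/x - m)⁻¹ = -(1/m + m⁻²/(x - 1/m)); the last fraction is the resolvent at
      -- l + 1/m.
      set S : H →L[ℂ] H := -((m : ℂ)⁻¹ • (1 : H →L[ℂ] H) + ((m : ℂ)⁻¹ ^ 2) • R₁) with hS
      refine ⟨⟨R - (m : ℂ) • (1 : H →L[ℂ] H), S, ?_, ?_⟩, rfl⟩
      · ext y
        have e := hres y
        have e' : R₁ y = R y + ((1 / m : ℝ) : ℂ) • R (R₁ y) := by
          rw [eq_comm, ← sub_eq_zero] at e ⊢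
          rw [← neg_eq_zero, ← e]; module
        simp only [hS, mul_apply_eq_comp, _root_.sub_apply,
          _root_.smul_apply, _root_.neg_apply,
          _root_.add_apply, one_apply_eq_self, map_neg, map_add, map_smul]
        have h3 : (m : ℂ)⁻¹ ^ 2 • (m : ℂ) • R₁ y = (m : ℂ)⁻¹ • R₁ y := by
          rw [smul_smul]; congr 1; field_simp
        have h4 : (m : ℂ)⁻¹ • ((m : ℂ) • y) = y := by
          rw [smul_smul, inv_mul_cancel₀ hmc, one_smul]
        rw [smul_sub, smul_sub, h3, h4, show (m : ℂ)⁻¹ • R₁ y = (m : ℂ)⁻¹ • R y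
          + (m : ℂ)⁻¹ • (((1 / m : ℝ) : ℂ) • R (R₁ y)) by rw [← smul_add, ← e']]
        push_cast
        simp only [one_div]
        module
      · ext y
        have e := hres' y
        have e' : R₁ y = R y + ((1 / m : ℝ) : ℂ) • R₁ (R y) := by
          rw [eq_comm, ← sub_eq_zero] at e ⊢
          rw [← neg_eq_zero, ← e]; module
        simp only [hS, mul_apply_eq_comp, _root_.sub_apply,
          _root_.smul_apply, _root_.neg_apply,
          _root_.add_apply, one_apply_eq_self, map_sub, map_smul]
        have h3 : (m : ℂ) • ((m : ℂ)⁻¹ ^ 2 • R₁ y) = (m : ℂ)⁻¹ • R₁ y := by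
          rw [smul_smul]; congr 1; field_simp
        have h4 : (m : ℂ) • ((m : ℂ)⁻¹ • y) = y := by
          rw [smul_smul, mul_inv_cancel₀ hmc, one_smul]
        rw [smul_neg, smul_add, h3, h4, e']
        push_cast
        simp only [one_div]
        module
    exact hinv
  have hpos := ((ContinuousLinearMap.nonneg_iff_isPositive _).1 hneg)
  have h5 := ((ContinuousLinearMap.isPositive_iff _).1 hpos).2 (A x - (l : ℂ) • (x : H))
  rw [_root_.neg_apply, hR1, inner_neg_left, inner_sub_right, inner_smul_right,
    ← hA] at h5
  have h6 := (Complex.le_def.1 h5).1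
  rw [inner_self_eq_norm_sq_to_K] at h6
  simp only [Complex.zero_re, Complex.neg_re, Complex.sub_re, Complex.mul_re, Complex.ofReal_re,
    Complex.ofReal_im, zero_mul, sub_zero] at h6
  have h7 : (((‖(x : H)‖ : ℝ) : ℂ) ^ 2).re = ‖(x : H)‖ ^ 2 := by
    rw [← Complex.ofReal_pow, Complex.ofReal_re]
  erw [h7] at h6
  linarith

end Abstract
end DiscreteSchrodinger

/-! ### Symmetry of the Schrödinger operator and point potentials -/

namespace DiscreteSchrodinger

open Filter Topology
open scoped InnerProductSpace

variable {d : ℕ}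

theorem mem_schrodinger_domain {V : Lattice d → ℝ} {x : ell2 d} :
    x ∈ (schrodinger V).domain ↔ Memℓp (fun n => (V n : ℂ) * x n) 2 := by
  change x ∈ (⊤ ⊓ potentialDomain V : Submodule ℂ (ell2 d)) ↔ _
  rw [top_inf_eq]; rfl

theorem schrodinger_apply (V : Lattice d → ℝ) (x : (schrodinger V).domain) (n : Lattice d) :
    (schrodinger V x) n = negLaplacianFun (x : ell2 d) n + (V n : ℂ) * (x : ell2 d) n := rfl

/-- Translation by `a` on `ℓ²(ℤ^d)`. -/
noncomputable def translate (a : Lattice d) (x : ell2 d) : ell2 d :=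
  ⟨fun n => x (n + a), memℓp_shift a (lp.memℓp x)⟩

theorem inner_translate (a : Lattice d) (x y : ell2 d) :
    ⟪translate a x, y⟫_ℂ = ⟪x, translate (-a) y⟫_ℂ := by
  rw [lp.inner_eq_tsum, lp.inner_eq_tsum, ← (Equiv.addRight (-a)).tsum_eq]
  refine tsum_congr fun n => ?_
  simp [translate]

theorem negLaplacian_eq (x : ell2 d) :
    negLaplacian d x = ∑ j : Fin d,
      ((x - translate (basisVec j) x) + (x - translate (-basisVec j) x)) := by
  ext n
  rw [lp.coeFn_sum, Finset.sum_apply]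
  change (∑ j : Fin d, (_ : ℂ)) = _
  refine Finset.sum_congr rfl fun j _ => ?_
  simp only [lp.coeFn_add, lp.coeFn_sub, Pi.add_apply, Pi.sub_apply, translate,
    sub_eq_add_neg (n : Lattice d)]

theorem negLaplacian_isSymmetric : (negLaplacian d).IsSymmetric := by
  intro x y
  rw [negLaplacian_eq, negLaplacian_eq, sum_inner, inner_sum]
  refine Finset.sum_congr rfl fun j _ => ?_
  simp only [inner_add_left, inner_sub_left, inner_add_right, inner_sub_right, inner_translate,
    neg_neg]
  ring

theorem inner_schrodinger (V : Lattice d → ℝ) (x y : (schrodinger V).domain) :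
    ⟪schrodinger V x, (y : ell2 d)⟫_ℂ = ⟪(x : ell2 d), schrodinger V y⟫_ℂ := by
  have h : ∀ z : (schrodinger V).domain, schrodinger V z
      = negLaplacian d z + potential V ⟨z, (Submodule.mem_inf.1 z.2).2⟩ := fun z => rfl
  rw [h, h, inner_add_left, inner_add_right, negLaplacian_isSymmetric (x : ell2 d) y]
  congr 1
  rw [lp.inner_eq_tsum, lp.inner_eq_tsum]
  refine tsum_congr fun n => ?_
  change ⟪(V n : ℂ) * (x : ell2 d) n, _⟫_ℂ = ⟪_, (V n : ℂ) * (y : ell2 d) n⟫_ℂ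
  simp
  ring

/-- The unit vector at the origin. -/
noncomputable def deltaZero (d : ℕ) : ell2 d := lp.single 2 0 1

theorem deltaZero_apply (n : Lattice d) : deltaZero d n = if n = 0 then 1 else 0 := by
  rw [deltaZero, lp.coeFn_single, Pi.single_apply]

/-- The potential equal to `c` at the origin and to `0` elsewhere. -/
noncomputable def pointPotential (c : ℝ) : Lattice d → ℝ := Pi.single 0 c

theorem pointPotential_mul_apply (c : ℝ) (x : Lattice d → ℂ) (n : Lattice d) :
    ((pointPotential c : Lattice d → ℝ) n : ℂ) * x n = (c * x 0) * deltaZero d n := by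
  rw [deltaZero_apply, pointPotential, Pi.single_apply]
  split_ifs with h
  · simp [h]
  · simp

theorem memℓp_pointPotential_mul (c : ℝ) (x : Lattice d → ℂ) :
    Memℓp (fun n => ((pointPotential c : Lattice d → ℝ) n : ℂ) * x n) 2 := by
  have h : (fun n => ((pointPotential c : Lattice d → ℝ) n : ℂ) * x n)
      = ((c : ℂ) * x 0) • (deltaZero d : Lattice d → ℂ) := funext (pointPotential_mul_apply c x)
  rw [h]
  exact (lp.memℓp (deltaZero d)).const_smul _

theorem isCompactPotential_pointPotential (c : ℝ) :
    IsCompactPotential (pointPotential c : Lattice d → ℝ) := by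
  let e : ell2 d →L[ℂ] ℂ := lp.evalCLM ℂ (fun _ : Lattice d => ℂ) 2 0
  have he : IsCompactOperator e := isCompactOperator_of_locallyCompactSpace_dom e
  let g : ℂ →L[ℂ] ell2 d := ContinuousLinearMap.toSpanSingleton ℂ ((c : ℂ) • deltaZero d)
  refine ⟨g ∘L e, he.clm_comp g, fun ψ n => ?_⟩
  rw [pointPotential_mul_apply]
  change (ψ 0 • ((c : ℂ) • deltaZero d)) n = _
  rw [lp.coeFn_smul, Pi.smul_apply, lp.coeFn_smul, Pi.smul_apply, smul_eq_mul, smul_eq_mul]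
  ring

theorem mem_schrodinger_add_pointPotential_domain {V : Lattice d → ℝ} {c : ℝ} {x : ell2 d} :
    x ∈ (schrodinger (V + pointPotential c)).domain ↔ x ∈ (schrodinger V).domain := by
  rw [mem_schrodinger_domain, mem_schrodinger_domain]
  have h : (fun n => (((V + pointPotential c : Lattice d → ℝ) n : ℝ) : ℂ) * x n)
      = (fun n => (V n : ℂ) * x n) + fun n => ((pointPotential c : Lattice d → ℝ) n : ℂ) * x n := by
    funext n
    simp [add_mul]
  rw [h]
  refine ⟨fun hx => ?_, fun hx => hx.add (memℓp_pointPotential_mul c x)⟩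
  simpa using hx.sub (memℓp_pointPotential_mul c x)

theorem schrodinger_add_pointPotential (V : Lattice d → ℝ) (c : ℝ) :
    schrodinger V + potential (pointPotential c) = schrodinger (V + pointPotential c) := by
  refine LinearPMap.ext (Submodule.ext fun x => ?_) fun x hx hx' => ?_
  · rw [mem_schrodinger_add_pointPotential_domain, LinearPMap.add_domain, Submodule.mem_inf]
    exact and_iff_left (memℓp_pointPotential_mul c x)
  · ext n
    rw [schrodinger_apply]
    change (negLaplacianFun x n + (V n : ℂ) * x n)
      + ((pointPotential c : Lattice d → ℝ) n : ℂ) * x n = negLaplacianFun x n + _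
    simp only [Pi.add_apply, Complex.ofReal_add]
    ring

end DiscreteSchrodinger

/-! ### The parity flip and the energy form -/

namespace DiscreteSchrodinger

open Filter Topology
open scoped InnerProductSpace

variable {d : ℕ}

/-- The operator `-Δ - V` acting on real functions; it is unitarily equivalent to `4d - H_V`. -/
noncomputable def flippedOp (V : Lattice d → ℝ) (f : Lattice d → ℝ) (n : Lattice d) : ℝ :=
  (2 * (d : ℝ) - V n) * f n - ∑ j : Fin d, (f (n + basisVec j) + f (n - basisVec j))

/-- The quadratic form of `-Δ - V` on functions supported in `B`. -/
noncomputable def energy (V : Lattice d → ℝ) (B : Finset (Lattice d)) (f : Lattice d → ℝ) : ℝ :=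
  ∑ n ∈ B, f n * flippedOp V f n

/-- The sign `(-1)^(n_1 + ⋯ + n_d)`. -/
noncomputable def parity (n : Lattice d) : ℝ := (-1) ^ (∑ j, n j)

theorem parity_add_basisVec (n : Lattice d) (j : Fin d) : parity (n + basisVec j) = -parity n := by
  have h : ∑ i, (n + basisVec j) i = ∑ i, n i + 1 := by
    simp [Finset.sum_add_distrib, basisVec]
  rw [parity, h, zpow_add₀ (by norm_num), parity]
  simp

theorem parity_sub_basisVec (n : Lattice d) (j : Fin d) : parity (n - basisVec j) = -parity n := by
  have h := parity_add_basisVec (n - basisVec j) j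
  rw [sub_add_cancel] at h
  linarith

theorem parity_mul_self (n : Lattice d) : parity n * parity n = 1 := by
  rw [parity, ← zpow_add₀ (by norm_num), ← two_mul, zpow_mul]
  norm_num

/-- Neighbouring sites have opposite parity, so only the hopping term changes sign. -/
theorem flippedOp_parity_mul (V f : Lattice d → ℝ) (n : Lattice d) :
    flippedOp V (fun m => parity m * f m) n = parity n *
      ((2 * (d : ℝ) - V n) * f n + ∑ j : Fin d, (f (n + basisVec j) + f (n - basisVec j))) := by
  simp only [flippedOp, parity_add_basisVec, parity_sub_basisVec, mul_add, Finset.mul_sum]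
  rw [sub_eq_add_neg, ← Finset.sum_neg_distrib]
  congr 1
  · ring
  · exact Finset.sum_congr rfl fun j _ => by ring

theorem re_inner_flip (V : Lattice d → ℝ) (z : Lattice d → ℂ) (n : Lattice d) :
    (⟪4 * (d : ℂ) * z n - (negLaplacianFun z n + (V n : ℂ) * z n), z n⟫_ℂ).re
      = (fun m => parity m * (z m).re) n * flippedOp V (fun m => parity m * (z m).re) n
      + (fun m => parity m * (z m).im) n * flippedOp V (fun m => parity m * (z m).im) n := by
  rw [flippedOp_parity_mul V (fun m => (z m).re), flippedOp_parity_mul V (fun m => (z m).im)]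
  have hre : (negLaplacianFun z n).re = 2 * d * (z n).re
      - ∑ j : Fin d, ((z (n + basisVec j)).re + (z (n - basisVec j)).re) := by
    rw [negLaplacianFun, Complex.re_sum]
    simp only [Complex.add_re, Complex.sub_re, Finset.sum_add_distrib, Finset.sum_sub_distrib]
    simp
    ring
  have him : (negLaplacianFun z n).im = 2 * d * (z n).im
      - ∑ j : Fin d, ((z (n + basisVec j)).im + (z (n - basisVec j)).im) := by
    rw [negLaplacianFun, Complex.im_sum]
    simp only [Complex.add_im, Complex.sub_im, Finset.sum_add_distrib, Finset.sum_sub_distrib]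
    simp
    ring
  have h4 : 4 * (d : ℂ) * z n = ((4 * d : ℝ) : ℂ) * z n := by push_cast; ring
  rw [h4]
  simp only [RCLike.inner_apply, Complex.im_ofReal_mul, Complex.mul_re, Complex.conj_re, Complex.conj_im, Complex.sub_re,
    Complex.sub_im, Complex.add_re, Complex.add_im, Complex.ofReal_re, Complex.ofReal_im,
    hre, him]
  linear_combination (-(z n).re * ((2 * (d : ℝ) - V n) * (z n).re
      + ∑ j : Fin d, ((z (n + basisVec j)).re + (z (n - basisVec j)).re))
    - (z n).im * ((2 * (d : ℝ) - V n) * (z n).im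
      + ∑ j : Fin d, ((z (n + basisVec j)).im + (z (n - basisVec j)).im))) * parity_mul_self n

/-- For finitely supported vectors the form of `4d - H_V` is the sum of the energies of the real
and imaginary parts. -/
theorem re_inner_flip_eq_energy (V : Lattice d → ℝ) (B : Finset (Lattice d))
    (x : (schrodinger V).domain) (hx : ∀ n ∉ B, (x : ell2 d) n = 0) :
    4 * (d : ℝ) * ‖(x : ell2 d)‖ ^ 2 - (⟪schrodinger V x, (x : ell2 d)⟫_ℂ).re
      = energy V B (fun m => parity m * ((x : ell2 d) m).re)
      + energy V B (fun m => parity m * ((x : ell2 d) m).im) := by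
  have h1 : 4 * (d : ℝ) * ‖(x : ell2 d)‖ ^ 2 - (⟪schrodinger V x, (x : ell2 d)⟫_ℂ).re
      = (⟪(4 * (d : ℂ)) • (x : ell2 d) - schrodinger V x, (x : ell2 d)⟫_ℂ).re := by
    rw [inner_sub_left, Complex.sub_re, inner_smul_left]
    have h2 := inner_self_eq_norm_sq_to_K (𝕜 := ℂ) (x : ell2 d)
    rw [h2]
    have : (starRingEnd ℂ) (4 * (d : ℂ)) = ((4 * d : ℝ) : ℂ) := by
      rw [← Complex.conj_ofReal]; simp
    have h3 : (((4 * d : ℝ) : ℂ) * ((‖(x : ell2 d)‖ : ℝ) : ℂ) ^ 2).re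
        = 4 * (d : ℝ) * ‖(x : ell2 d)‖ ^ 2 := by
      rw [← Complex.ofReal_pow, ← Complex.ofReal_mul, Complex.ofReal_re]
    rw [this]
    erw [h3]
  rw [h1, lp.inner_eq_tsum, tsum_eq_sum (s := B), Complex.re_sum, energy, energy,
    ← Finset.sum_add_distrib]
  · refine Finset.sum_congr rfl fun n _ => ?_
    rw [← re_inner_flip]
    rfl
  · intro n hn
    rw [hx n hn, inner_zero_right]

/-- The vector is `parity * f`, whose imaginary part contributes no energy. This transfers form
bounds for `H_V` to real functions. -/
theorem exists_energy_parity (V : Lattice d → ℝ) (B : Finset (Lattice d)) (f : Lattice d → ℝ)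
    (hf : ∀ n ∉ B, f n = 0) : ∃ x : (schrodinger V).domain,
      energy V B f = 4 * (d : ℝ) * ‖(x : ell2 d)‖ ^ 2
        - (⟪schrodinger V x, (x : ell2 d)⟫_ℂ).re := by
  have hfin : ∀ g : Lattice d → ℂ, (∀ n ∉ B, g n = 0) → Memℓp g 2 := fun g hg =>
    (memℓp_zero (B.finite_toSet.subset fun n hn => by
      by_contra h; exact hn (hg n h))).of_exponent_ge (zero_le)
  let y : ell2 d := ⟨fun n => ((parity n * f n : ℝ) : ℂ), hfin _ fun n hn => by simp [hf n hn]⟩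
  have hy : ∀ n, y n = ((parity n * f n : ℝ) : ℂ) := fun n => rfl
  refine ⟨⟨y, mem_schrodinger_domain.2 (hfin _ fun n hn => by simp [hy, hf n hn])⟩, ?_⟩
  rw [re_inner_flip_eq_energy V B _ fun n hn => by simp [hy, hf n hn]]
  have h1 : (fun m => parity m * (y m).re) = f := by
    funext m
    rw [hy, Complex.ofReal_re, ← mul_assoc, parity_mul_self, one_mul]
  have h2 : (fun m => parity m * (y m).im) = 0 := by
    funext m
    rw [hy, Complex.ofReal_im, mul_zero]; rfl
  simp only [h1, h2]
  simp [energy]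

/-- Lower bounds for the energy extend from finitely supported functions to the operator domain. -/
theorem mul_sq_le_of_energy (V : Lattice d → ℝ) (c : ℝ)
    (h : ∀ (B : Finset (Lattice d)) (f : Lattice d → ℝ), (∀ n ∉ B, f n = 0) →
      c * f 0 ^ 2 ≤ energy V B f) (x : (schrodinger V).domain) :
    c * ‖(x : ell2 d) 0‖ ^ 2
      ≤ 4 * (d : ℝ) * ‖(x : ell2 d)‖ ^ 2 - (⟪schrodinger V x, (x : ell2 d)⟫_ℂ).re := by
  classical
  let W : ell2 d := ⟨fun n => (V n : ℂ) * (x : ell2 d) n, mem_schrodinger_domain.1 x.2⟩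
  let tr : ell2 d → Finset (Lattice d) → ell2 d := fun y S => ∑ i ∈ S, lp.single 2 i (y i)
  have htr : ∀ y, Tendsto (tr y) atTop (𝓝 y) := fun y => lp.hasSum_single (by norm_num) y
  have htra : ∀ y S n, tr y S n = if n ∈ S then y n else 0 := by
    intro y S n
    simp only [tr]
    rw [lp.coeFn_sum, Finset.sum_apply]
    simp only [lp.coeFn_single, Pi.single_apply]
    rw [Finset.sum_ite_eq]
  -- Truncation commutes with multiplication by V, so the truncations converge to x in the graph
  -- norm.
  have hW : ∀ S, (tr W S : Lattice d → ℂ) = fun n => (V n : ℂ) * tr x S n := by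
    intro S
    funext n
    rw [htra, htra]
    split_ifs
    · rfl
    · simp
  have hdom : ∀ S, tr x S ∈ (schrodinger V).domain := fun S =>
    mem_schrodinger_domain.2 (hW S ▸ lp.memℓp (tr W S))
  have hop : ∀ S, schrodinger V ⟨tr x S, hdom S⟩ = negLaplacian d (tr x S) + tr W S := by
    intro S
    ext n
    rw [schrodinger_apply, lp.coeFn_add, Pi.add_apply, hW]
    rfl
  have hopx : schrodinger V x = negLaplacian d x + W := rfl
  -- Hellinger-Toeplitz: a symmetric operator defined everywhere is bounded.
  have hcont : Continuous (negLaplacian d) := negLaplacian_isSymmetric.continuous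
  have ht1 : Tendsto (fun S => 4 * (d : ℝ) * ‖tr x S‖ ^ 2
      - (⟪negLaplacian d (tr x S) + tr W S, tr x S⟫_ℂ).re) atTop
      (𝓝 (4 * (d : ℝ) * ‖(x : ell2 d)‖ ^ 2 - (⟪schrodinger V x, (x : ell2 d)⟫_ℂ).re)) := by
    rw [hopx]
    refine ((htr x).norm.pow 2 |>.const_mul _).sub ?_
    refine (Complex.continuous_re.tendsto _).comp ?_
    exact (((hcont.tendsto _).comp (htr x)).add (htr W)).inner (htr x)
  have ht2 : Tendsto (fun S => c * ‖tr x S 0‖ ^ 2) atTop (𝓝 (c * ‖(x : ell2 d) 0‖ ^ 2)) := by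
    refine (Tendsto.norm ?_).pow 2 |>.const_mul _
    exact ((lp.evalCLM ℂ (fun _ : Lattice d => ℂ) 2 0).continuous.tendsto _).comp (htr x)
  refine le_of_tendsto_of_tendsto' ht2 ht1 fun S => ?_
  have hS0 : ∀ n ∉ S, tr x S n = 0 := fun n hn => by rw [htra, if_neg hn]
  have e := re_inner_flip_eq_energy V S ⟨tr x S, hdom S⟩ hS0
  rw [hop] at e
  simp only at e ⊢
  rw [e]
  have h1 := h S (fun m => parity m * (tr x S m).re) fun n hn => by rw [hS0 n hn]; simp
  have h2 := h S (fun m => parity m * (tr x S m).im) fun n hn => by rw [hS0 n hn]; simp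
  have h3 : ‖tr x S 0‖ ^ 2 = (parity (0 : Lattice d) * (tr x S 0).re) ^ 2
      + (parity (0 : Lattice d) * (tr x S 0).im) ^ 2 := by
    rw [← Complex.normSq_eq_norm_sq, Complex.normSq_apply]
    linear_combination (-(tr x S 0).re ^ 2 - (tr x S 0).im ^ 2) * parity_mul_self (0 : Lattice d)
  rw [h3]
  linarith

/-! ### Rank-one perturbations and the meaning of criticality -/

theorem add_pointPotential_apply (V : Lattice d → ℝ) (c : ℝ) (x : (schrodinger V).domain)
    (x' : (schrodinger (V + pointPotential c)).domain) (h : (x : ell2 d) = x') :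
    schrodinger (V + pointPotential c) x'
      = schrodinger V x + ((c : ℂ) * (x : ell2 d) 0) • deltaZero d := by
  ext n
  change negLaplacianFun (x' : ell2 d) n + ((V n + pointPotential c n : ℝ) : ℂ) * (x' : ell2 d) n
    = (negLaplacianFun (x : ell2 d) n + (V n : ℂ) * (x : ell2 d) n)
      + ((c : ℂ) * (x : ell2 d) 0) * deltaZero d n
  rw [← pointPotential_mul_apply, ← h, Complex.ofReal_add]
  ring

/-- The resolvent of a rank-one perturbation (the Sherman-Morrison formula). -/
theorem mem_resolventSet_add_pointPotential {V : Lattice d → ℝ} {c : ℝ} {z : ℂ} {R : ell2 d →L[ℂ] ell2 d}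
    (h1 : ∀ x : (schrodinger V).domain, R (schrodinger V x - z • (x : ell2 d)) = x)
    (h2 : ∀ y : ell2 d, ∃ x : (schrodinger V).domain, (x : ell2 d) = R y ∧
      schrodinger V x - z • (x : ell2 d) = y)
    (hk : 1 + (c : ℂ) * R (deltaZero d) 0 ≠ 0) :
    z ∈ resolventSet (schrodinger (V + pointPotential c)) := by
  set k : ℂ := 1 + (c : ℂ) * R (deltaZero d) 0 with hkd
  let e : ell2 d →L[ℂ] ℂ := lp.evalCLM ℂ (fun _ : Lattice d => ℂ) 2 0
  have he : ∀ y : ell2 d, e y = y 0 := fun y => rfl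
  let P : ell2 d →L[ℂ] ell2 d := ContinuousLinearMap.toSpanSingleton ℂ (R (deltaZero d)) ∘L e
  have hP : ∀ y, P y = (y 0) • R (deltaZero d) := fun y => rfl
  let R' : ell2 d →L[ℂ] ell2 d := R - ((c : ℂ) / k) • (P ∘L R)
  have hR' : ∀ y, R' y = R y - ((c : ℂ) / k * R y 0) • R (deltaZero d) := by
    intro y
    change R y - ((c : ℂ) / k) • P (R y) = _
    rw [hP, smul_smul]
  refine ⟨R', fun x' => ?_, fun y => ?_⟩
  · obtain ⟨x, hx⟩ : ∃ x : (schrodinger V).domain, (x : ell2 d) = x' :=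
      ⟨⟨x', mem_schrodinger_add_pointPotential_domain.1 x'.2⟩, rfl⟩
    rw [add_pointPotential_apply V c x x' hx, ← hx, hR']
    have h3 : R (schrodinger V x + ((c : ℂ) * (x : ell2 d) 0) • deltaZero d - z • (x : ell2 d))
        = x + ((c : ℂ) * (x : ell2 d) 0) • R (deltaZero d) := by
      rw [add_sub_right_comm, map_add, h1, map_smul]
    rw [h3, lp.coeFn_add, Pi.add_apply, lp.coeFn_smul, Pi.smul_apply, smul_eq_mul]
    have h4 : (c : ℂ) / k * ((x : ell2 d) 0 + (c : ℂ) * (x : ell2 d) 0 * R (deltaZero d) 0)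
        = (c : ℂ) * (x : ell2 d) 0 := by
      field_simp
      rw [hkd]; ring
    rw [h4, add_sub_cancel_right]
  · obtain ⟨x₁, hx₁, hx₁'⟩ := h2 y
    obtain ⟨x₂, hx₂, hx₂'⟩ := h2 (deltaZero d)
    set a : ℂ := (c : ℂ) / k * R y 0 with ha
    let x : (schrodinger V).domain := x₁ - a • x₂
    have hx : (x : ell2 d) = R' y := by
      change (x₁ : ell2 d) - a • (x₂ : ell2 d) = _
      rw [hR', hx₁, hx₂]
    refine ⟨⟨x, mem_schrodinger_add_pointPotential_domain.2 x.2⟩, hx, ?_⟩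
    rw [add_pointPotential_apply V c x _ rfl]
    have h3 : schrodinger V x = schrodinger V x₁ - a • schrodinger V x₂ := by
      change schrodinger V (x₁ - a • x₂) = _
      rw [LinearPMap.map_sub, LinearPMap.map_smul]
    have h4 : (x : ell2 d) = (x₁ : ell2 d) - a • (x₂ : ell2 d) := rfl
    have h5 : (c : ℂ) * (x : ell2 d) 0 = a := by
      rw [hx, hR', lp.coeFn_sub, Pi.sub_apply, lp.coeFn_smul, Pi.smul_apply, smul_eq_mul, ha]
      field_simp
      rw [hkd]; ring
    change schrodinger V x + ((c : ℂ) * (x : ell2 d) 0) • deltaZero d - z • (x : ell2 d) = y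
    rw [h5, h3, h4, ← hx₁', ← hx₂']
    module

theorem mem_resolventSet_of_lt {A : ell2 d →ₗ.[ℂ] ell2 d} {E : ℝ}
    (h : E ∈ upperBounds (realPoints (spec A))) {l : ℝ} (hl : E < l) : (l : ℂ) ∈ resolventSet A := by
  by_contra hc
  exact absurd (h (show l ∈ realPoints (spec A) from hc)) (not_le.2 hl)

theorem energy_nonneg_of_upperBound {V : Lattice d → ℝ}
    (h : 4 * (d : ℝ) ∈ upperBounds (realPoints (spec (schrodinger V))))
    (B : Finset (Lattice d)) (f : Lattice d → ℝ) (hf : ∀ n ∉ B, f n = 0) : 0 ≤ energy V B f := by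
  obtain ⟨x, hx⟩ := exists_energy_parity V B f hf
  rw [hx]
  have := re_inner_le_of_forall_mem_resolventSet (schrodinger V) (inner_schrodinger V) _
    (fun l hl => mem_resolventSet_of_lt h hl) x
  linarith

theorem inner_deltaZero (x : ell2 d) : ⟪deltaZero d, x⟫_ℂ = x 0 := by
  rw [deltaZero, lp.inner_single_left]; simp

/-- A critical operator has finitely supported trial functions whose energy is arbitrarily small
compared with their value at the origin. -/
theorem exists_energy_lt_of_isCritical {V : Lattice d → ℝ}
    (hV : IsCriticalFromAbove V (4 * (d : ℝ))) {c : ℝ} (hc : 0 < c) :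
    ∃ (B : Finset (Lattice d)) (f : Lattice d → ℝ), (∀ n ∉ B, f n = 0) ∧
      energy V B f < c * f 0 ^ 2 := by
  by_contra hcon
  push Not at hcon
  obtain ⟨hlub, hcrit⟩ := hV
  have hne : ¬ IsLUB (realPoints (spec (schrodinger (V + pointPotential c)))) (4 * (d : ℝ)) := by
    intro h
    have h0 := hcrit (pointPotential c)
      (fun n => by rw [pointPotential, Pi.single_apply]; split_ifs <;> simp [hc.le])
      (isCompactPotential_pointPotential c) (by rwa [schrodinger_add_pointPotential])
    have := congrFun h0 0
    simp [pointPotential] at this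
    exact hc.ne' this
  apply hne
  constructor
  · intro l hl
    by_contra hlt
    push Not at hlt
    obtain ⟨R, h1, h2⟩ := mem_resolventSet_of_lt hlub.1 hlt
    apply hl
    apply mem_resolventSet_add_pointPotential h1 h2
    -- A zero of the Sherman-Morrison denominator gives x = R δ₀ with x(0) = -1/c. The assumed bound
    -- then reads 1/c ≤ 1/c - (l - 4d)‖x‖², impossible for x ≠ 0.
    intro hk
    obtain ⟨x, hx, hx'⟩ := h2 (deltaZero d)
    rw [← hx] at hk
    have hE := mul_sq_le_of_energy V c hcon x
    have hHx : schrodinger V x = deltaZero d + (l : ℂ) • (x : ell2 d) := by rw [← hx']; simp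
    have hcc : (c : ℂ) ≠ 0 := by exact_mod_cast hc.ne'
    have hx0 : (x : ell2 d) 0 = ((-1 / c : ℝ) : ℂ) := by
      push_cast
      field_simp
      linear_combination hk
    rw [hHx, inner_add_left, inner_deltaZero, inner_smul_left, inner_self_eq_norm_sq_to_K, hx0]
      at hE
    have h3 : (((-1 / c : ℝ) : ℂ) + (starRingEnd ℂ) (l : ℂ)
        * ((‖(x : ell2 d)‖ : ℝ) : ℂ) ^ 2).re = -1 / c + l * ‖(x : ell2 d)‖ ^ 2 := by
      rw [Complex.conj_ofReal]
      norm_cast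
    erw [h3] at hE
    rw [Complex.norm_real, Real.norm_eq_abs, sq_abs] at hE
    have h4 : c * (-1 / c) ^ 2 = 1 / c := by field_simp
    have h5 : 0 < ‖(x : ell2 d)‖ := by
      rw [norm_pos_iff]
      intro h
      rw [h] at hx0
      have h6 : (0 : ℂ) = ((-1 / c : ℝ) : ℂ) := hx0
      have h7 : (0 : ℝ) = -1 / c := by exact_mod_cast h6
      have := one_div_pos.2 hc
      rw [neg_div] at h7
      linarith
    have h6 : 0 < (l - 4 * d) * ‖(x : ell2 d)‖ ^ 2 := mul_pos (by linarith) (by positivity)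
    rw [h4, neg_div] at hE
    linarith
  · intro E hE
    refine hlub.2 fun l hl => ?_
    by_contra hlt
    push Not at hlt
    obtain ⟨R, h1, h2⟩ := mem_resolventSet_of_lt hE hlt
    apply hl
    -- For leastness the perturbation is undone: an upper bound E for the perturbed spectrum also
    -- bounds the original one.
    have hVV : V = (V + pointPotential c) + pointPotential (-c) := by
      rw [add_assoc, pointPotential, pointPotential, ← Pi.single_add]; simp
    rw [hVV]
    apply mem_resolventSet_add_pointPotential h1 h2
    -- The form bound at E gives Re x(0) ≤ (E - l)‖x‖² ≤ 0, so the denominator 1 - c x(0) has real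
    -- part at least 1.
    obtain ⟨x, hx, hx'⟩ := h2 (deltaZero d)
    rw [← hx]
    have hform := re_inner_le_of_forall_mem_resolventSet _ (inner_schrodinger _) _
      (fun l hl => mem_resolventSet_of_lt hE hl) x
    have hHx : schrodinger (V + pointPotential c) x = deltaZero d + (l : ℂ) • (x : ell2 d) := by
      rw [← hx']; simp
    rw [hHx, inner_add_left, inner_deltaZero, inner_smul_left, inner_self_eq_norm_sq_to_K] at hform
    have h3 : ((x : ell2 d) 0 + (starRingEnd ℂ) (l : ℂ)
        * ((‖(x : ell2 d)‖ : ℝ) : ℂ) ^ 2).re = ((x : ell2 d) 0).re + l * ‖(x : ell2 d)‖ ^ 2 := by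
      rw [Complex.conj_ofReal, Complex.add_re]
      norm_cast
    erw [h3] at hform
    intro hk
    have hk' := congrArg Complex.re hk
    rw [Complex.add_re, Complex.re_ofReal_mul] at hk'
    simp at hk'
    have h4 : (E - l) * ‖(x : ell2 d)‖ ^ 2 ≤ 0 :=
      mul_nonpos_of_nonpos_of_nonneg (by linarith) (by positivity)
    have h5 : c * ((x : ell2 d) 0).re ≤ 0 :=
      mul_nonpos_of_nonneg_of_nonpos hc.le (by linarith)
    linarith

end DiscreteSchrodinger

/-! ### Maximum principle and Green's functions on finite sets -/

namespace DiscreteSchrodinger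

open Filter Topology
open scoped InnerProductSpace

variable {d : ℕ}

theorem flippedOp_add_mul (V f g : Lattice d → ℝ) (t : ℝ) (n : Lattice d) :
    flippedOp V (fun m => f m + t * g m) n = flippedOp V f n + t * flippedOp V g n := by
  simp only [flippedOp, mul_sub, Finset.mul_sum]
  rw [← add_sub_add_comm, ← Finset.sum_add_distrib]
  congr 1
  · ring
  · exact Finset.sum_congr rfl fun j _ => by ring

theorem flippedOp_const_mul (V g : Lattice d → ℝ) (t : ℝ) (n : Lattice d) :
    flippedOp V (fun m => t * g m) n = t * flippedOp V g n := by
  simp only [flippedOp, mul_sub, Finset.mul_sum]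
  congr 1
  · ring
  · exact Finset.sum_congr rfl fun j _ => by ring

/-- The off-diagonal entries are nonpositive, so replacing neighbours by their positive parts can
only lower the value where w > 0. This is what makes the maximum principle work. -/
theorem max_mul_flippedOp_le (V w : Lattice d → ℝ) (n : Lattice d) :
    max (w n) 0 * flippedOp V (fun m => max (w m) 0) n ≤ max (w n) 0 * flippedOp V w n := by
  rcases le_or_gt (w n) 0 with h | h
  · simp [max_eq_right h]
  · refine mul_le_mul_of_nonneg_left ?_ (le_max_right _ _)
    rw [flippedOp, flippedOp, max_eq_left h.le]
    gcongr <;> exact le_max_left _ _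

/-- Nonnegativity of the quadratic form of `-Δ - V`. -/
def EnergyNonneg (V : Lattice d → ℝ) : Prop :=
  ∀ (B : Finset (Lattice d)) (f : Lattice d → ℝ), (∀ n ∉ B, f n = 0) → 0 ≤ energy V B f

section Finite

variable {V : Lattice d → ℝ}

/-- The maximum principle for `-Δ - V + l` on a finite set. -/
theorem nonpos_of_flippedOp_le (hV : EnergyNonneg V) {B : Finset (Lattice d)} {l : ℝ} (hl : 0 < l) {w : Lattice d → ℝ}
    (hout : ∀ n ∉ B, w n ≤ 0) (hin : ∀ n ∈ B, 0 < w n → flippedOp V w n + l * w n ≤ 0)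
    (n : Lattice d) : w n ≤ 0 := by
  set p : Lattice d → ℝ := fun m => max (w m) 0 with hp
  have h0 := hV B p fun m hm => max_eq_right (hout m hm)
  have h1 : ∑ m ∈ B, p m * flippedOp V p m + ∑ m ∈ B, l * p m ^ 2 ≤ 0 := by
    rw [← Finset.sum_add_distrib]
    refine Finset.sum_nonpos fun m hm => ?_
    rcases le_or_gt (w m) 0 with h | h
    · simp [hp, max_eq_right h]
    · have h2 := max_mul_flippedOp_le V w m
      have h3 := hin m hm h
      have h4 : p m = w m := max_eq_left h.le
      have h5 : p m * flippedOp V p m ≤ p m * flippedOp V w m := h2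
      have h6 : w m * (flippedOp V w m + l * w m) ≤ 0 :=
        mul_nonpos_of_nonneg_of_nonpos h.le h3
      rw [h4] at h5 ⊢
      nlinarith
  have h2 : ∑ m ∈ B, l * p m ^ 2 = 0 := by
    refine le_antisymm ?_ (Finset.sum_nonneg fun m _ => by positivity)
    unfold energy at h0
    linarith
  by_contra hn
  push Not at hn
  have hnB : n ∈ B := by
    by_contra h
    exact absurd (hout n h) (not_le.2 hn)
  have h3 := (Finset.sum_eq_zero_iff_of_nonneg fun m _ => by positivity).1 h2 n hnB
  have h4 : p n = w n := max_eq_left hn.le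
  rw [h4] at h3
  have : 0 < l * w n ^ 2 := by positivity
  linarith

/-- The Green's function of `-Δ - V + l` on a finite set with zero boundary values. -/
theorem exists_green (hV : EnergyNonneg V) (B : Finset (Lattice d)) {l : ℝ} (hl : 0 < l) :
    ∃ g : Lattice d → ℝ, (∀ n ∉ B, g n = 0) ∧
      ∀ n ∈ B, flippedOp V g n + l * g n = if n = 0 then 1 else 0 := by
  classical
  let ext : (B → ℝ) → Lattice d → ℝ := fun v n => if h : n ∈ B then v ⟨n, h⟩ else 0
  have hext : ∀ v, ∀ n ∉ B, ext v n = 0 := fun v n hn => dif_neg hn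
  have hextB : ∀ v (n : B), ext v n = v n := fun v n => dif_pos n.2
  have hadd : ∀ v w t, ext (v + t • w) = fun m => ext v m + t * ext w m := by
    intro v w t
    funext m
    simp only [ext]
    split_ifs <;> simp
  let T : (B → ℝ) →ₗ[ℝ] (B → ℝ) :=
    { toFun := fun v n => flippedOp V (ext v) n + l * v n
      map_add' := fun v w => by
        funext n
        have h := hadd v w 1
        rw [one_smul] at h
        simp only [h, flippedOp_add_mul, Pi.add_apply]
        ring
      map_smul' := fun t v => by
        funext n
        have h : ext (t • v) = fun m => t * ext v m := by
          funext m
          simp only [ext]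
          split_ifs <;> simp
        simp only [h, flippedOp_const_mul, Pi.smul_apply, smul_eq_mul, RingHom.id_apply]
        ring }
  have hT : ∀ v (n : B), T v n = flippedOp V (ext v) n + l * ext v n := fun v n => by
    rw [hextB]; rfl
  -- The maximum principle applied to v and -v kills the kernel; finite dimension then gives
  -- surjectivity.
  have hinj : Function.Injective T := by
    rw [injective_iff_map_eq_zero]
    intro v hv
    have hz : ∀ n ∈ B, flippedOp V (ext v) n + l * ext v n = 0 := fun n hn => by
      rw [← hT v ⟨n, hn⟩, hv]; rfl
    have h1 := nonpos_of_flippedOp_le hV hl (fun n hn => (hext v n hn).le)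
      (fun n hn _ => (hz n hn).le)
    have h2 := nonpos_of_flippedOp_le hV hl (w := fun n => (-1) * ext v n)
      (fun n hn => by rw [hext v n hn]; simp)
      (fun n hn _ => by
        rw [flippedOp_const_mul]
        linarith [hz n hn])
    funext n
    rw [← hextB v n, Pi.zero_apply]
    linarith [h1 n, h2 n]
  obtain ⟨v, hv⟩ := (LinearMap.injective_iff_surjective.1 hinj)
    (fun n => if (n : Lattice d) = 0 then 1 else 0)
  exact ⟨ext v, hext v, fun n hn => by rw [← hT v ⟨n, hn⟩, hv]⟩

theorem green_nonneg (hV : EnergyNonneg V) {B : Finset (Lattice d)} {l : ℝ} (hl : 0 < l) {g : Lattice d → ℝ}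
    (hg : ∀ n ∉ B, g n = 0)
    (hg' : ∀ n ∈ B, flippedOp V g n + l * g n = if n = 0 then 1 else 0) (n : Lattice d) :
    0 ≤ g n := by
  have := nonpos_of_flippedOp_le hV hl (w := fun n => (-1) * g n) (B := B)
    (fun n hn => by rw [hg n hn]; simp)
    (fun n hn _ => by
      rw [flippedOp_const_mul]
      have h1 := hg' n hn
      have h2 : (0 : ℝ) ≤ if n = 0 then 1 else 0 := by split_ifs <;> norm_num
      linarith) n
  linarith

theorem sum_mul_translate {B : Finset (Lattice d)} {f g : Lattice d → ℝ} (hf : ∀ n ∉ B, f n = 0)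
    (hg : ∀ n ∉ B, g n = 0) (a : Lattice d) :
    ∑ n ∈ B, f n * g (n + a) = ∑ n ∈ B, g n * f (n - a) := by
  have h1 : ∑' n, f n * g (n + a) = ∑ n ∈ B, f n * g (n + a) :=
    tsum_eq_sum fun n hn => by rw [hf n hn, zero_mul]
  have h2 : ∑' n, g n * f (n - a) = ∑ n ∈ B, g n * f (n - a) :=
    tsum_eq_sum fun n hn => by rw [hg n hn, zero_mul]
  rw [← h1, ← h2, ← (Equiv.addRight a).tsum_eq fun n => g n * f (n - a)]
  exact tsum_congr fun n => by simp [mul_comm]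

/-- Self-adjointness with zero boundary values: translation by a basis vector has the opposite
translation as its adjoint. -/
theorem sum_mul_flippedOp_comm {B : Finset (Lattice d)} {f g : Lattice d → ℝ}
    (hf : ∀ n ∉ B, f n = 0) (hg : ∀ n ∉ B, g n = 0) :
    ∑ n ∈ B, f n * flippedOp V g n = ∑ n ∈ B, g n * flippedOp V f n := by
  simp only [flippedOp, mul_sub, Finset.sum_sub_distrib, Finset.mul_sum]
  congr 1
  · exact Finset.sum_congr rfl fun n _ => by ring
  · rw [Finset.sum_comm, Finset.sum_comm (s := B)]
    refine Finset.sum_congr rfl fun j _ => ?_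
    simp only [mul_add, Finset.sum_add_distrib]
    rw [sum_mul_translate hf hg, ← sum_mul_translate hg hf, add_comm]

/-- Cauchy-Schwarz for the form of L + l, in which g represents evaluation at the origin: the form
at f - t g is a nonnegative quadratic in t, so its discriminant is nonpositive. A trial function of
small energy thus forces g(0) to be large. -/
theorem sq_le_green_mul (hV : EnergyNonneg V) {B : Finset (Lattice d)} (h0 : (0 : Lattice d) ∈ B) {l : ℝ} (hl : 0 < l)
    {f g : Lattice d → ℝ} (hf : ∀ n ∉ B, f n = 0) (hg : ∀ n ∉ B, g n = 0)
    (hg' : ∀ n ∈ B, flippedOp V g n + l * g n = if n = 0 then 1 else 0) :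
    f 0 ^ 2 ≤ g 0 * (energy V B f + l * ∑ n ∈ B, f n ^ 2) := by
  have key : ∀ h : Lattice d → ℝ, ∑ n ∈ B, h n * (flippedOp V g n + l * g n) = h 0 := by
    intro h
    rw [Finset.sum_congr rfl fun n hn => by rw [hg' n hn]]
    simp [h0]
  have hquad : ∀ t : ℝ, 0 ≤ g 0 * (t * t) + (-2 * f 0) * t
      + (energy V B f + l * ∑ n ∈ B, f n ^ 2) := by
    intro t
    have h1 := hV B (fun m => f m + (-t) * g m) fun n hn => by rw [hf n hn, hg n hn]; simp
    have h2 : 0 ≤ ∑ n ∈ B, l * (f n + (-t) * g n) ^ 2 :=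
      Finset.sum_nonneg fun n _ => by positivity
    have h3 := sum_mul_flippedOp_comm (V := V) hf hg
    have h4 := key f
    have h5 := key g
    simp only [energy, flippedOp_add_mul] at h1 ⊢
    have h6 : ∑ n ∈ B, (f n + -t * g n) * (flippedOp V f n + -t * flippedOp V g n)
        + ∑ n ∈ B, l * (f n + (-t) * g n) ^ 2
        = ∑ n ∈ B, f n * flippedOp V f n + l * ∑ n ∈ B, f n ^ 2
          - t * (∑ n ∈ B, g n * flippedOp V f n - ∑ n ∈ B, f n * flippedOp V g n)
          - 2 * t * ∑ n ∈ B, f n * (flippedOp V g n + l * g n)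
          + t ^ 2 * ∑ n ∈ B, g n * (flippedOp V g n + l * g n) := by
      simp only [Finset.mul_sum, ← Finset.sum_add_distrib, ← Finset.sum_sub_distrib]
      exact Finset.sum_congr rfl fun n _ => by ring
    rw [h4, h5, h3] at h6
    linarith
  have := discrim_le_zero hquad
  rw [discrim] at this
  linarith

end Finite

/-! ### Exhaustion and construction of the ground state -/

theorem energy_of_subset {V : Lattice d → ℝ} {B C : Finset (Lattice d)} (h : B ⊆ C)
    {f : Lattice d → ℝ} (hf : ∀ n ∉ B, f n = 0) : energy V C f = energy V B f :=
  (Finset.sum_subset h fun n _ hn => by rw [hf n hn, zero_mul]).symm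

/-- The cube of side `2k + 1` centred at the origin. -/
noncomputable def cube (d k : ℕ) : Finset (Lattice d) := Finset.Icc (fun _ => -(k : ℤ)) (fun _ => (k : ℤ))

theorem mem_cube {k : ℕ} {n : Lattice d} : n ∈ cube d k ↔ ∀ j, |n j| ≤ k := by
  rw [cube, Finset.mem_Icc, Pi.le_def, Pi.le_def, ← forall_and]
  exact forall_congr' fun j => abs_le.symm

theorem eventually_mem_cube (n : Lattice d) : ∀ᶠ k in atTop, n ∈ cube d k := by
  filter_upwards [eventually_ge_atTop (∑ j, (n j).natAbs)] with k hk
  rw [mem_cube]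
  intro j
  have h1 : (n j).natAbs ≤ ∑ j, (n j).natAbs :=
    Finset.single_le_sum (f := fun j => (n j).natAbs) (fun _ _ => Nat.zero_le _) (Finset.mem_univ j)
  rw [Int.abs_eq_natAbs]
  exact_mod_cast h1.trans hk

/-- Approximate ground states of a critical operator on an exhausting sequence of finite sets. -/
theorem exists_approximate_groundState {V : Lattice d → ℝ}
    (hV : IsCriticalFromAbove V (4 * (d : ℝ))) (k : ℕ) :
    ∃ (B : Finset (Lattice d)) (l c : ℝ) (p : Lattice d → ℝ), cube d k ⊆ B ∧
      0 < l ∧ l ≤ 1 / (k + 1) ∧ 0 ≤ c ∧ c ≤ 1 / (k + 1) ∧ p 0 = 1 ∧ (∀ n, 0 ≤ p n) ∧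
      (∀ n ∉ B, p n = 0) ∧ ∀ n ∈ B, flippedOp V p n + l * p n = if n = 0 then c else 0 := by
  classical
  have hE : EnergyNonneg V := fun B f hf => energy_nonneg_of_upperBound hV.1.1 B f hf
  have hk : (0 : ℝ) < 1 / (k + 1) := by positivity
  obtain ⟨B₀, f, hf, hfE⟩ := exists_energy_lt_of_isCritical hV hk
  set B := B₀ ∪ cube d k with hB
  have hfB : ∀ n ∉ B, f n = 0 := fun n hn => hf n fun h => hn (Finset.mem_union_left _ h)
  rw [← energy_of_subset (Finset.subset_union_left (s₂ := cube d k)) hf] at hfE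
  have h0 : (0 : Lattice d) ∈ B := Finset.mem_union_right _ (mem_cube.2 fun j => by simp)
  set S := ∑ n ∈ B, f n ^ 2 with hS
  have hS0 : 0 ≤ S := Finset.sum_nonneg fun n _ => by positivity
  set gap := 1 / ((k : ℝ) + 1) * f 0 ^ 2 - energy V B f with hgap
  have hgap0 : 0 < gap := by linarith
  -- Small enough that the mass term l Σ f² does not use up the gap, so the energy with mass stays
  -- below f(0)²/(k+1) and g(0) ≥ k + 1 follows.
  set l := min (1 / ((k : ℝ) + 1)) (gap / (S + 1)) with hl
  have hl0 : 0 < l := lt_min hk (by positivity)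
  have hlS : l * S < gap := by
    have h1 : l * (S + 1) ≤ gap := by
      rw [← le_div_iff₀ (by positivity)]
      exact min_le_right _ _
    nlinarith
  obtain ⟨g, hg, hg'⟩ := exists_green hE B hl0
  have hsq := sq_le_green_mul hE h0 hl0 hfB hg hg'
  have hgn := green_nonneg hE hl0 hg hg'
  have hEf := hE B f hfB
  have hf0 : 0 < f 0 ^ 2 := by
    by_contra h
    have h1 : f 0 ^ 2 = 0 := le_antisymm (not_lt.1 h) (sq_nonneg _)
    rw [h1] at hfE
    linarith
  have hg0 : (k : ℝ) + 1 ≤ g 0 := by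
    by_contra h
    push Not at h
    have hX : energy V B f + l * S < f 0 ^ 2 / (k + 1) := by
      have : f 0 ^ 2 / ((k : ℝ) + 1) = 1 / ((k : ℝ) + 1) * f 0 ^ 2 := by ring
      linarith
    have hXn : 0 ≤ energy V B f + l * S := by positivity
    have h1 : g 0 * (energy V B f + l * S) ≤ (k + 1) * (energy V B f + l * S) :=
      mul_le_mul_of_nonneg_right h.le hXn
    have h2 : ((k : ℝ) + 1) * (energy V B f + l * S) < (k + 1) * (f 0 ^ 2 / (k + 1)) :=
      mul_lt_mul_of_pos_left hX (by positivity)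
    rw [mul_div_cancel₀ _ (by positivity)] at h2
    linarith
  have hg0p : 0 < g 0 := lt_of_lt_of_le (by positivity) hg0
  refine ⟨B, l, (g 0)⁻¹, fun n => (g 0)⁻¹ * g n, Finset.subset_union_right, hl0, min_le_left _ _,
    (inv_pos.2 hg0p).le, ?_, inv_mul_cancel₀ hg0p.ne', fun n => mul_nonneg (inv_pos.2 hg0p).le (hgn n),
    fun n hn => by simp [hg n hn], fun n hn => ?_⟩
  · rw [inv_eq_one_div]
    exact one_div_le_one_div_of_le (by positivity) hg0
  · rw [flippedOp_const_mul, mul_left_comm, ← mul_add, hg' n hn]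
    split_ifs <;> simp

/-- Connectedness of the lattice; it propagates the Harnack bound from the origin to every site. -/
theorem eq_univ_of_closed_basisVec {T : Set (Lattice d)} (h0 : 0 ∈ T)
    (hadd : ∀ n ∈ T, ∀ j, n + basisVec j ∈ T) (hsub : ∀ n ∈ T, ∀ j, n - basisVec j ∈ T)
    (n : Lattice d) : n ∈ T := by
  classical
  have h1 : ∀ m ∈ T, ∀ (j : Fin d) (a : ℤ), m + Pi.single j a ∈ T := by
    intro m hm j a
    induction a with
    | zero => simpa using hm
    | succ i ih =>
      have := hadd _ ih j
      rwa [basisVec, add_assoc, ← Pi.single_add] at this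
    | pred i ih =>
      have := hsub _ ih j
      rwa [basisVec, add_sub_assoc, ← Pi.single_sub] at this
  have h2 : ∀ s : Finset (Fin d), ∑ j ∈ s, (Pi.single j (n j) : Lattice d) ∈ T := by
    intro s
    induction s using Finset.induction_on with
    | empty => simpa using h0
    | insert j s hj ih =>
      rw [Finset.sum_insert hj, add_comm]
      exact h1 _ ih j _
  have h3 := h2 Finset.univ
  rwa [Finset.univ_sum_single] at h3

/-- A critical operator with a positive square-summable supersolution of `(-Δ - V) u ≥ 0` near
infinity has `4d` as an eigenvalue. -/
theorem mem_pointSpec_of_supersolution {V : Lattice d → ℝ}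
    (hV : IsCriticalFromAbove V (4 * (d : ℝ))) {u : Lattice d → ℝ} (hu : ∀ n, 0 < u n)
    (hsum : Summable fun n => u n ^ 2) (K : Finset (Lattice d))
    (hK : ∀ n ∉ K, 0 ≤ flippedOp V u n) :
    ((4 * (d : ℝ) : ℝ) : ℂ) ∈ pointSpec (schrodinger V) := by
  classical
  have hE : EnergyNonneg V := fun B f hf => energy_nonneg_of_upperBound hV.1.1 B f hf
  choose B l c p hcube hl hl1 hc hc1 hp0 hpn hpB hpe using exists_approximate_groundState hV
  -- a pointwise bound, by Harnack's inequality along lattice paths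
  have hone : ∀ k : ℕ, 1 / ((k : ℝ) + 1) ≤ 1 := fun k => by
    rw [div_le_one (by positivity)]
    have := Nat.cast_nonneg (α := ℝ) k
    linarith
  have hev : ∀ n, ∀ᶠ k in atTop, n ∈ B k := fun n =>
    (eventually_mem_cube n).mono fun k hk => hcube k hk
  have hbound : ∀ n, ∃ C, ∀ᶠ k in atTop, p k n ≤ C := by
    have hstep : ∀ n, (∃ C, ∀ᶠ k in atTop, p k n ≤ C) → ∃ C, ∀ᶠ k in atTop, ∀ j,
        p k (n + basisVec j) + p k (n - basisVec j) ≤ C := by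
      rintro n ⟨C, hC⟩
      refine ⟨(|2 * (d : ℝ) - V n| + 1) * C, ?_⟩
      filter_upwards [hC, hev n] with k hk hnk j
      have h1 := hpe k n hnk
      have h2 : (0 : ℝ) ≤ if n = 0 then c k else 0 := by split_ifs <;> simp [hc k]
      rw [flippedOp] at h1
      have h3 : p k (n + basisVec j) + p k (n - basisVec j)
          ≤ ∑ j, (p k (n + basisVec j) + p k (n - basisVec j)) :=
        Finset.single_le_sum (f := fun j => p k (n + basisVec j) + p k (n - basisVec j))
          (fun i _ => add_nonneg (hpn _ _) (hpn _ _)) (Finset.mem_univ j)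
      have h4 : (2 * (d : ℝ) - V n) * p k n ≤ |2 * (d : ℝ) - V n| * p k n :=
        mul_le_mul_of_nonneg_right (le_abs_self _) (hpn _ _)
      have h5 : l k * p k n ≤ 1 * p k n :=
        mul_le_mul_of_nonneg_right ((hl1 k).trans (hone k)) (hpn _ _)
      have h6 : (|2 * (d : ℝ) - V n| + 1) * p k n ≤ (|2 * (d : ℝ) - V n| + 1) * C :=
        mul_le_mul_of_nonneg_left hk (by positivity)
      linarith
    refine eq_univ_of_closed_basisVec (T := {n | ∃ C, ∀ᶠ k in atTop, p k n ≤ C})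
      ⟨1, Eventually.of_forall fun k => (hp0 k).le⟩ ?_ ?_
    · intro n hn j
      obtain ⟨C, hC⟩ := hstep n hn
      exact ⟨C, hC.mono fun k hk => by linarith [hk j, hpn k (n - basisVec j)]⟩
    · intro n hn j
      obtain ⟨C, hC⟩ := hstep n hn
      exact ⟨C, hC.mono fun k hk => by linarith [hk j, hpn k (n + basisVec j)]⟩
  choose C hC using hbound
  -- comparison with the supersolution
  set M : ℝ := ∑ n ∈ K, |C n| / u n with hM
  have hM0 : 0 ≤ M := Finset.sum_nonneg fun n _ => div_nonneg (abs_nonneg _) (hu n).le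
  -- M makes D u dominate the approximants on K; the summand 1/u(0) gives D u(0) ≥ 1 = p_k(0), so
  -- the source c_k at the origin never enters the maximum principle.
  set D : ℝ := M + 1 / u 0 with hD
  have hD0 : 0 ≤ D := add_nonneg hM0 (one_div_pos.2 (hu 0)).le
  have hcomp : ∀ᶠ k in atTop, ∀ n, p k n ≤ D * u n := by
    have hKe : ∀ᶠ k in atTop, ∀ n ∈ K, p k n ≤ C n :=
      (Finset.eventually_all K).2 fun n _ => hC n
    filter_upwards [hKe] with k hk n
    have := nonpos_of_flippedOp_le hE (hl k) (w := fun m => p k m + (-D) * u m) (B := B k)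
      (fun m hm => by
        rw [hpB k m hm]
        have := mul_nonneg hD0 (hu m).le
        linarith)
      (fun m hm hpos => by
        by_cases hmK : m ∈ K
        · exfalso
          have h1 : |C m| / u m ≤ M := Finset.single_le_sum (f := fun n => |C n| / u n)
            (fun n _ => div_nonneg (abs_nonneg _) (hu n).le) hmK
          rw [div_le_iff₀ (hu m)] at h1
          have h2 : M * u m ≤ D * u m := mul_le_mul_of_nonneg_right
            (by have := (one_div_pos.2 (hu 0)).le; linarith) (hu m).le
          linarith [hk m hmK, le_abs_self (C m)]
        · by_cases hm0 : m = 0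
          · exfalso
            subst hm0
            have h1 : D * u 0 = M * u 0 + 1 := by
              rw [hD, add_mul, one_div, inv_mul_cancel₀ (hu 0).ne']
            have h2 := mul_nonneg hM0 (hu 0).le
            have h3 := hp0 k
            linarith
          · rw [flippedOp_add_mul]
            have h1 := hpe k m hm
            rw [if_neg hm0] at h1
            have h2 := mul_nonneg hD0 (hK m hmK)
            have h3 := mul_nonneg (hl k).le (mul_nonneg hD0 (hu m).le)
            linarith) n
    linarith
  -- the limit along an ultrafilter
  have hle : (hyperfilter ℕ : Filter ℕ) ≤ atTop := Nat.hyperfilter_le_atTop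
  -- One ultrafilter gives convergence at all sites at once, in place of a diagonal subsequence.
  have hlim : ∀ n, ∃ y, Tendsto (fun k => p k n) (hyperfilter ℕ) (𝓝 y) := by
    intro n
    obtain ⟨y, -, hy⟩ := (isCompact_Icc (a := (0 : ℝ)) (b := C n)).ultrafilter_le_nhds
      ((hyperfilter ℕ).map fun k => p k n) (by
        rw [le_principal_iff]
        change ∀ᶠ k in (hyperfilter ℕ : Filter ℕ), p k n ∈ Set.Icc 0 (C n)
        exact hle ((hC n).mono fun k hk => ⟨hpn k n, hk⟩))
    exact ⟨y, hy⟩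
  choose φ hφ using hlim
  have hφ0 : φ 0 = 1 := by
    refine tendsto_nhds_unique (hφ 0) ?_
    simp only [hp0]
    exact tendsto_const_nhds
  have hφn : ∀ n, 0 ≤ φ n := fun n => ge_of_tendsto' (hφ n) fun k => hpn k n
  have hφu : ∀ n, φ n ≤ D * u n := fun n =>
    le_of_tendsto (hφ n) (hle (hcomp.mono fun k hk => hk n))
  have hinv : Tendsto (fun k : ℕ => 1 / ((k : ℝ) + 1)) (hyperfilter ℕ) (𝓝 0) :=
    tendsto_one_div_add_atTop_nhds_zero_nat.mono_left hle
  have hl0 : Tendsto l (hyperfilter ℕ) (𝓝 0) :=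
    squeeze_zero (fun k => (hl k).le) hl1 hinv
  have hc0 : Tendsto c (hyperfilter ℕ) (𝓝 0) := squeeze_zero hc hc1 hinv
  have hφL : ∀ n, flippedOp V φ n = 0 := by
    intro n
    have h1 : Tendsto (fun k => flippedOp V (p k) n + l k * p k n) (hyperfilter ℕ)
        (𝓝 (flippedOp V φ n + 0 * φ n)) := by
      refine Tendsto.add ?_ (hl0.mul (hφ n))
      exact ((hφ n).const_mul _).sub (tendsto_finsetSum _ fun j _ => (hφ _).add (hφ _))
    have h2 : Tendsto (fun k => if n = 0 then c k else 0) (hyperfilter ℕ) (𝓝 0) := by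
      split_ifs
      · exact hc0
      · exact tendsto_const_nhds
    have h3 := tendsto_nhds_unique (h1.congr' (hle ((hev n).mono fun k hk => hpe k n hk))) h2
    linarith
  -- the eigenvector
  have hmem : Memℓp (fun n => ((parity n * φ n : ℝ) : ℂ)) 2 := by
    rw [memℓp_gen_iff (by norm_num)]
    refine Summable.of_nonneg_of_le (fun n => by positivity) (fun n => ?_) (hsum.mul_left (D ^ 2))
    have h1 : ‖((parity n * φ n : ℝ) : ℂ)‖ = φ n := by
      rw [Complex.norm_real, Real.norm_eq_abs, abs_mul, abs_of_nonneg (hφn n)]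
      have h2 : |parity n| = 1 := by
        rw [← sq_eq_sq₀ (abs_nonneg _) zero_le_one, sq_abs, sq, parity_mul_self, one_pow]
      rw [h2, one_mul]
    rw [h1, ENNReal.toReal_ofNat, Real.rpow_ofNat, ← mul_pow]
    exact pow_le_pow_left₀ (hφn n) (hφu n) 2
  let ψ : ell2 d := ⟨_, hmem⟩
  have hψ : ∀ n, ψ n = ((parity n * φ n : ℝ) : ℂ) := fun n => rfl
  have heq : ∀ n, negLaplacianFun ψ n + (V n : ℂ) * ψ n = ((4 * (d : ℝ) : ℝ) : ℂ) * ψ n := by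
    intro n
    have h1 := hφL n
    simp only [negLaplacianFun, hψ, parity_add_basisVec, parity_sub_basisVec]
    norm_cast
    have h2 : ∑ j : Fin d, (parity n * φ n - -parity n * φ (n + basisVec j)
        + (parity n * φ n - -parity n * φ (n - basisVec j)))
        = parity n * (2 * d * φ n + ∑ j : Fin d, (φ (n + basisVec j) + φ (n - basisVec j))) := by
      rw [mul_add, Finset.mul_sum, show parity n * (2 * d * φ n) = ∑ _j : Fin d, 2 * parity n * φ n by
        rw [Finset.sum_const, Finset.card_univ, Fintype.card_fin, nsmul_eq_mul]; ring,
        ← Finset.sum_add_distrib]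
      exact Finset.sum_congr rfl fun j _ => by ring
    rw [flippedOp] at h1
    rw [h2]
    push_cast
    linear_combination (-parity n) * h1
  refine ⟨⟨ψ, ?_⟩, ?_, ?_⟩
  · rw [mem_schrodinger_domain]
    -- The eigenvalue equation expresses Vψ through ψ and the bounded Laplacian, so ψ lies in the
    -- maximal domain.
    have h1 : (fun n => (V n : ℂ) * ψ n)
        = ((((4 * (d : ℝ) : ℝ) : ℂ) • ψ - negLaplacian d ψ : ell2 d) : Lattice d → ℂ) := by
      funext n
      change _ = ((4 * (d : ℝ) : ℝ) : ℂ) * ψ n - negLaplacianFun ψ n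
      rw [← heq n]; ring
    rw [h1]
    exact lp.memℓp _
  · intro h
    have h1 : ψ 0 = 0 := by
      change ψ = 0 at h
      rw [h]; rfl
    rw [hψ, hφ0] at h1
    have h2 : parity (0 : Lattice d) = 1 := by simp [parity]
    rw [h2] at h1
    simp at h1
  · ext n
    exact heq n

end DiscreteSchrodinger

namespace DiscreteSchrodinger

open Filter Topology

variable {d : ℕ}

/-! ### Iterated logarithms -/

theorem logIter_zero (x : ℝ) : logIter 0 x = x := rfl

theorem logIter_succ (k : ℕ) (x : ℝ) : logIter (k + 1) x = Real.log (logIter k x) := by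
  rw [logIter, logIter, Function.iterate_succ_apply']

theorem tendsto_logIter (k : ℕ) : Tendsto (logIter k) atTop atTop := by
  induction k with
  | zero => exact tendsto_id
  | succ k ih =>
    have h : logIter (k + 1) = Real.log ∘ logIter k := funext (logIter_succ k)
    rw [h]
    exact Real.tendsto_log_atTop.comp ih

theorem eventually_one_le_logIter (s : ℕ) : ∀ᶠ r in atTop, ∀ i ≤ s, 1 ≤ logIter i r := by
  have h : ∀ᶠ r in atTop, ∀ i ∈ Finset.range (s + 1), 1 ≤ logIter i r :=
    (Finset.eventually_all _).2 fun i _ => (tendsto_logIter i).eventually_ge_atTop 1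
  exact h.mono fun r hr i hi => hr i (Finset.mem_range.2 (by omega))

theorem exists_one_le_logIter (s : ℕ) : ∃ R : ℝ, 1 ≤ R ∧ ∀ r, R ≤ r → ∀ i ≤ s, 1 ≤ logIter i r := by
  obtain ⟨R, hR⟩ := eventually_atTop.1 (eventually_one_le_logIter s)
  exact ⟨max 1 R, le_max_left _ _, fun r hr => hR r ((le_max_right _ _).trans hr)⟩

theorem logIter_le_logIter {s : ℕ} {x y : ℝ} (hx : ∀ i ≤ s, 1 ≤ logIter i x) (hxy : x ≤ y) :
    ∀ i ≤ s, logIter i x ≤ logIter i y := by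
  intro i
  induction i with
  | zero => exact fun _ => hxy
  | succ i ih =>
    intro hi
    rw [logIter_succ, logIter_succ]
    exact Real.log_le_log (by linarith [hx i (by omega)]) (ih (by omega))

theorem hasDerivAt_logIter {s : ℕ} {x : ℝ} (hx : ∀ i ≤ s, 1 ≤ logIter i x) :
    ∀ i ≤ s, HasDerivAt (logIter i) (∏ k ∈ Finset.range i, (logIter k x)⁻¹) x := by
  intro i
  induction i with
  | zero => exact fun _ => by rw [Finset.prod_range_zero]; exact hasDerivAt_id x
  | succ i ih =>
    intro hi
    have h : logIter (i + 1) = fun y => Real.log (logIter i y) := funext (logIter_succ i)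
    rw [h, Finset.prod_range_succ, ← div_eq_mul_inv]
    exact (ih (by omega)).log (by linarith [hx i (by omega)])

theorem prod_Icc_one_eq {M : Type*} [CommMonoid M] (s : ℕ) (f : ℕ → M) :
    ∏ i ∈ Finset.Icc 1 s, f i = ∏ i ∈ Finset.range s, f (i + 1) := by
  rw [← Finset.Ico_add_one_right_eq_Icc, Finset.prod_Ico_eq_prod_range]
  simp [add_comm]

/-- The density whose tail integral is `(log_s r)^(-a) / a`. -/
noncomputable def logDensity (s : ℕ) (a r : ℝ) : ℝ :=
  logIter s r ^ (-a) * ∏ k ∈ Finset.range (s + 1), (logIter k r)⁻¹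

theorem logDensity_nonneg {s : ℕ} {a r : ℝ} (hr : ∀ i ≤ s, 1 ≤ logIter i r) :
    0 ≤ logDensity s a r :=
  mul_nonneg (Real.rpow_nonneg (by linarith [hr s le_rfl]) _) (Finset.prod_nonneg fun k hk =>
    inv_nonneg.2 (by linarith [hr k (by have := Finset.mem_range.1 hk; omega)]))

theorem logDensity_anti {s : ℕ} {a x y : ℝ} (ha : 0 ≤ a) (hx : ∀ i ≤ s, 1 ≤ logIter i x)
    (hxy : x ≤ y) : logDensity s a y ≤ logDensity s a x := by
  have hm := logIter_le_logIter hx hxy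
  have hy : ∀ i ≤ s, 1 ≤ logIter i y := fun i hi => (hx i hi).trans (hm i hi)
  refine mul_le_mul ?_ ?_ ?_ ?_
  · exact Real.rpow_le_rpow_of_nonpos (by linarith [hx s le_rfl]) (hm s le_rfl) (by linarith)
  · refine Finset.prod_le_prod (fun k hk => ?_) fun k hk => ?_
    · exact inv_nonneg.2 (by linarith [hy k (by have := Finset.mem_range.1 hk; omega)])
    · have hks : k ≤ s := by have := Finset.mem_range.1 hk; omega
      exact inv_anti₀ (by linarith [hx k hks]) (hm k hks)
  · exact Finset.prod_nonneg fun k hk =>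
      inv_nonneg.2 (by linarith [hy k (by have := Finset.mem_range.1 hk; omega)])
  · exact Real.rpow_nonneg (by linarith [hx s le_rfl]) _

theorem hasDerivAt_logIter_rpow {s : ℕ} {x : ℝ} (hx : ∀ i ≤ s, 1 ≤ logIter i x) (a : ℝ) :
    HasDerivAt (fun r => logIter s r ^ (-a)) (-(a * logDensity s a x)) x := by
  have h0 : 0 < logIter s x := by linarith [hx s le_rfl]
  have h := (hasDerivAt_logIter hx s le_rfl).rpow_const (p := -a) (Or.inl h0.ne')
  convert h using 1
  rw [logDensity, Finset.prod_range_succ, Real.rpow_sub_one h0.ne']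
  field_simp

/-- Integral test by telescoping: the mean value theorem and monotonicity bound a times each term by
a difference of consecutive values of (log_s)^(-a). -/
theorem summable_logDensity (s : ℕ) {a : ℝ} (ha : 0 < a) :
    Summable fun k : ℕ => logDensity s a (k + 1) := by
  obtain ⟨R, hR1, hR⟩ := exists_one_le_logIter s
  obtain ⟨K, hK⟩ := exists_nat_ge R
  rw [← summable_nat_add_iff K]
  have hge : ∀ k : ℕ, R ≤ (k + K : ℝ) := fun k => by
    have := Nat.cast_nonneg (α := ℝ) k
    linarith
  set Φ : ℕ → ℝ := fun k => logIter s (k + K : ℝ) ^ (-a) with hΦ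
  have hΦ0 : ∀ k, 0 ≤ Φ k := fun k =>
    Real.rpow_nonneg (by linarith [hR _ (hge k) s le_rfl]) _
  have hstep : ∀ k : ℕ, a * logDensity s a (((k + K : ℕ) : ℝ) + 1) ≤ Φ k - Φ (k + 1) := by
    intro k
    have hx : ∀ x ∈ Set.Icc (k + K : ℝ) (k + K + 1), ∀ i ≤ s, 1 ≤ logIter i x :=
      fun x hx => hR x ((hge k).trans hx.1)
    obtain ⟨ξ, hξ, he⟩ := exists_hasDerivAt_eq_slope (fun r => logIter s r ^ (-a))
      (fun x => -(a * logDensity s a x)) (show (k + K : ℝ) < k + K + 1 by linarith)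
      (fun x hx' => (hasDerivAt_logIter_rpow (hx x hx') a).continuousAt.continuousWithinAt)
      (fun x hx' => hasDerivAt_logIter_rpow (hx x ⟨hx'.1.le, hx'.2.le⟩) a)
    have h1 : logDensity s a (k + K + 1) ≤ logDensity s a ξ :=
      logDensity_anti ha.le (hx ξ ⟨hξ.1.le, hξ.2.le⟩) hξ.2.le
    have h2 : Φ (k + 1) = logIter s (k + K + 1 : ℝ) ^ (-a) := by
      simp only [hΦ]
      push_cast
      ring_nf
    have h3 : Φ k = logIter s (k + K : ℝ) ^ (-a) := rfl
    rw [show (k + K + 1 : ℝ) - (k + K) = 1 by ring, div_one] at he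
    rw [h2, h3]
    push_cast
    have h4 := mul_le_mul_of_nonneg_left h1 ha.le
    linarith
  refine summable_of_sum_range_le (c := Φ 0 / a) (fun k => logDensity_nonneg (hR _ ?_)) fun n => ?_
  · push_cast
    linarith [hge k]
  · rw [le_div_iff₀ ha, mul_comm, Finset.mul_sum]
    calc _ ≤ ∑ k ∈ Finset.range n, (Φ k - Φ (k + 1)) := Finset.sum_le_sum fun k _ => hstep k
      _ = Φ 0 - Φ n := Finset.sum_range_sub' Φ n
      _ ≤ Φ 0 := by linarith [hΦ0 n]

/-! ### Lattice sums -/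

theorem card_cube (k : ℕ) : (cube d k).card = (2 * k + 1) ^ d := by
  rw [cube, Pi.card_Icc]
  simp only [Int.card_Icc, Finset.prod_const, Finset.card_univ, Fintype.card_fin]
  congr 1
  omega

theorem cube_mono {k l : ℕ} (h : k ≤ l) : cube d k ⊆ cube d l := fun n hn =>
  mem_cube.2 fun j => (mem_cube.1 hn j).trans (by exact_mod_cast h)

theorem pow_sub_pow_le_mul {a b : ℝ} (hb : 0 ≤ b) (hab : b ≤ a) (m : ℕ) :
    a ^ (m + 1) - b ^ (m + 1) ≤ (m + 1) * a ^ m * (a - b) := by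
  induction m with
  | zero => simp
  | succ m ih =>
    have h1 : b ^ (m + 1) ≤ a ^ (m + 1) := pow_le_pow_left₀ hb hab _
    have h2 := mul_le_mul_of_nonneg_left ih (hb.trans hab)
    have h3 := mul_le_mul_of_nonneg_right h1 (sub_nonneg.2 hab)
    have h4 : a ^ (m + 1 + 1) - b ^ (m + 1 + 1)
        = a * (a ^ (m + 1) - b ^ (m + 1)) + b ^ (m + 1) * (a - b) := by ring
    have h5 : a * ((m + 1) * a ^ m * (a - b)) + a ^ (m + 1) * (a - b)
        = ((m + 1 : ℕ) + 1) * a ^ (m + 1) * (a - b) := by push_cast; ring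
    linarith

/-- The shell has the order k^m in dimension m + 1, matching the factor r^(-m) in the squared
profile. -/
theorem card_shell_le (m k : ℕ) :
    ((cube (m + 1) (k + 1) \ cube (m + 1) k).card : ℝ) ≤ 2 * (m + 1) * (2 * k + 3) ^ m := by
  rw [Finset.card_sdiff_of_subset (cube_mono (Nat.le_succ k)),
    Nat.cast_sub (Finset.card_le_card (cube_mono (Nat.le_succ k))), card_cube, card_cube]
  push_cast
  have h := pow_sub_pow_le_mul (a := 2 * k + 3) (b := 2 * k + 1) (by positivity)
    (by linarith) m
  rw [show (2 * ((k : ℝ) + 1) + 1) = 2 * k + 3 by ring]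
  linarith

/-- Summation over cubical shells. -/
theorem summable_of_le_on_shells {m : ℕ} {h : Lattice (m + 1) → ℝ} (h0 : ∀ n, 0 ≤ h n) {a : ℕ → ℝ}
    (ha : ∀ k, 0 ≤ a k)
    (hle : ∀ k, ∀ n, n ∉ cube (m + 1) k → h n ≤ a k)
    (hsum : Summable fun k : ℕ => (2 * k + 3 : ℝ) ^ m * a k) : Summable h := by
  have hstep : ∀ K : ℕ, ∑ n ∈ cube (m + 1) K, h n ≤ ∑ n ∈ cube (m + 1) 0, h n
      + ∑ k ∈ Finset.range K, 2 * (m + 1) * ((2 * k + 3 : ℝ) ^ m * a k) := by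
    intro K
    induction K with
    | zero => simp
    | succ K ih =>
      rw [← Finset.sum_sdiff (cube_mono (Nat.le_succ K)), Finset.sum_range_succ]
      have h1 : ∑ n ∈ cube (m + 1) (K + 1) \ cube (m + 1) K, h n
          ≤ 2 * (m + 1) * ((2 * K + 3 : ℝ) ^ m * a K) := by
        refine (Finset.sum_le_card_nsmul _ _ (a K) fun n hn =>
          hle K n (Finset.mem_sdiff.1 hn).2).trans ?_
        rw [nsmul_eq_mul, ← mul_assoc]
        exact mul_le_mul_of_nonneg_right (card_shell_le m K) (ha K)
      linarith
  have hs := hsum.mul_left (2 * ((m : ℝ) + 1))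
  refine summable_of_sum_le h0 (c := ∑ n ∈ cube (m + 1) 0, h n
      + ∑' k : ℕ, 2 * (m + 1) * ((2 * k + 3 : ℝ) ^ m * a k)) fun S => ?_
  obtain ⟨K, hK⟩ := ((Finset.eventually_all S).2 fun n _ => eventually_mem_cube n).exists
  calc ∑ n ∈ S, h n ≤ ∑ n ∈ cube (m + 1) K, h n :=
        Finset.sum_le_sum_of_subset_of_nonneg hK fun n _ _ => h0 n
    _ ≤ _ := hstep K
    _ ≤ _ := by
      gcongr
      exact hs.sum_le_tsum _ fun k _ => by have := ha k; positivity

theorem latNorm_nonneg (n : Lattice d) : 0 ≤ latNorm n := Real.sqrt_nonneg _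

theorem latNorm_sq (n : Lattice d) : latNorm n ^ 2 = ∑ j, (n j : ℝ) ^ 2 :=
  Real.sq_sqrt (Finset.sum_nonneg fun _ _ => sq_nonneg _)

theorem abs_apply_le_latNorm (n : Lattice d) (j : Fin d) : |(n j : ℝ)| ≤ latNorm n := by
  rw [← Real.sqrt_sq_eq_abs]
  exact Real.sqrt_le_sqrt
    (Finset.single_le_sum (f := fun j => (n j : ℝ) ^ 2) (fun _ _ => sq_nonneg _) (Finset.mem_univ j))

theorem le_latNorm_of_notMem_cube {k : ℕ} {n : Lattice d} (h : n ∉ cube d k) :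
    (k : ℝ) + 1 ≤ latNorm n := by
  rw [mem_cube] at h
  push Not at h
  obtain ⟨j, hj⟩ := h
  have h1 : ((k + 1 : ℤ) : ℝ) ≤ ((|n j| : ℤ) : ℝ) := by exact_mod_cast hj
  push_cast at h1
  exact h1.trans (abs_apply_le_latNorm n j)

theorem finite_latNorm_lt (R : ℝ) : {n : Lattice d | latNorm n < R}.Finite := by
  obtain ⟨k, hk⟩ := exists_nat_ge R
  refine (cube d k).finite_toSet.subset fun n hn => ?_
  by_contra h
  have := le_latNorm_of_notMem_cube h
  have hn' : latNorm n < R := hn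
  linarith

theorem latNorm_add_basisVec_sq (n : Lattice d) (j : Fin d) :
    latNorm (n + basisVec j) ^ 2 = latNorm n ^ 2 + 1 + 2 * n j := by
  have h : ∀ i, (((n + basisVec j) i : ℤ) : ℝ) ^ 2
      = (n i : ℝ) ^ 2 + if i = j then 1 + 2 * (n i : ℝ) else 0 := by
    intro i
    rw [Pi.add_apply, basisVec, Pi.single_apply]
    split_ifs
    · push_cast; ring
    · simp
  rw [latNorm_sq, latNorm_sq, Finset.sum_congr rfl fun i _ => h i, Finset.sum_add_distrib,
    Finset.sum_ite_eq' Finset.univ j, if_pos (Finset.mem_univ j)]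
  ring

theorem latNorm_sub_basisVec_sq (n : Lattice d) (j : Fin d) :
    latNorm (n - basisVec j) ^ 2 = latNorm n ^ 2 + 1 - 2 * n j := by
  have h := latNorm_add_basisVec_sq (n - basisVec j) j
  rw [sub_add_cancel] at h
  have h2 : (((n - basisVec j) j : ℤ) : ℝ) = n j - 1 := by simp [basisVec]
  rw [h2] at h
  linarith

theorem sub_one_le_latNorm_add (n : Lattice d) (j : Fin d) :
    latNorm n - 1 ≤ latNorm (n + basisVec j) := by
  refine le_trans (le_abs_self _) (abs_le_of_sq_le_sq ?_ (latNorm_nonneg _))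
  rw [latNorm_add_basisVec_sq]
  linarith [(abs_le.1 (abs_apply_le_latNorm n j)).1]

theorem sub_one_le_latNorm_sub (n : Lattice d) (j : Fin d) :
    latNorm n - 1 ≤ latNorm (n - basisVec j) := by
  refine le_trans (le_abs_self _) (abs_le_of_sq_le_sq ?_ (latNorm_nonneg _))
  rw [latNorm_sub_basisVec_sq]
  linarith [(abs_le.1 (abs_apply_le_latNorm n j)).2]

/-! ### The radial comparison function -/

/-- The function `r^{-d/2} ∏ (log_i r)^{-1/2} (log_s r)^{-ε}`. -/
noncomputable def radialProfile (d s : ℕ) (ε r : ℝ) : ℝ :=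
  r ^ (-((d : ℝ) / 2)) * (∏ i ∈ Finset.Icc 1 s, (Real.sqrt (logIter i r))⁻¹) * logIter s r ^ (-ε)

theorem radialProfile_pos {s : ℕ} {ε r : ℝ} (hr : ∀ i ≤ s, 1 ≤ logIter i r) :
    0 < radialProfile d s ε r := by
  have h0 : 0 < r := by linarith [hr 0 (Nat.zero_le _), logIter_zero r]
  have h1 : 0 < logIter s r := by linarith [hr s le_rfl]
  refine mul_pos (mul_pos (Real.rpow_pos_of_pos h0 _) (Finset.prod_pos fun i hi => ?_))
    (Real.rpow_pos_of_pos h1 _)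
  exact inv_pos.2 (Real.sqrt_pos.2 (by linarith [hr i (Finset.mem_Icc.1 hi).2]))

/-- Turns the hypothesis on V into the supersolution inequality for the radial profile. -/
theorem comparisonTerm_eq {s : ℕ} {ε : ℝ} {n m : Lattice d}
    (hn : ∀ i ≤ s, 1 ≤ logIter i (latNorm n)) (hm : ∀ i ≤ s, 1 ≤ logIter i (latNorm m)) :
    comparisonTerm s ε n m
      = radialProfile d s ε (latNorm m) / radialProfile d s ε (latNorm n) := by
  have hn0 : 0 < latNorm n := by linarith [hn 0 (Nat.zero_le _), logIter_zero (latNorm n)]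
  have hm0 : 0 < latNorm m := by linarith [hm 0 (Nat.zero_le _), logIter_zero (latNorm m)]
  have hns : 0 < logIter s (latNorm n) := by linarith [hn s le_rfl]
  have hms : 0 < logIter s (latNorm m) := by linarith [hm s le_rfl]
  rw [comparisonTerm, radialProfile, radialProfile, mul_div_mul_comm, mul_div_mul_comm,
    ← Finset.prod_div_distrib, Real.div_rpow hn0.le hm0.le, Real.div_rpow hns.le hms.le,
    Real.rpow_neg hn0.le, Real.rpow_neg hm0.le, Real.rpow_neg hns.le, Real.rpow_neg hms.le,
    inv_div_inv, inv_div_inv]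
  congr 2
  refine Finset.prod_congr rfl fun i hi => ?_
  rw [inv_div_inv, Real.sqrt_div (by linarith [hn i (Finset.mem_Icc.1 hi).2])]

/-- The exponents -d/2, -1/2 and -ε double to cancel the surface growth r^(d-1) and leave exactly
the summable density with parameter 2ε. -/
theorem radialProfile_sq {m s : ℕ} {ε r : ℝ} (hr : ∀ i ≤ s, 1 ≤ logIter i r) :
    radialProfile (m + 1) s ε r ^ 2 = (r ^ m)⁻¹ * logDensity s (2 * ε) r := by
  have h0 : 0 < r := by linarith [hr 0 (Nat.zero_le _), logIter_zero r]
  have h1 : 0 < logIter s r := by linarith [hr s le_rfl]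
  rw [radialProfile, logDensity, mul_pow, mul_pow, ← Finset.prod_pow, Finset.prod_range_succ',
    prod_Icc_one_eq, logIter_zero]
  have h2 : (r ^ (-(((m + 1 : ℕ) : ℝ) / 2))) ^ 2 = (r ^ m)⁻¹ * r⁻¹ := by
    rw [← Real.rpow_natCast (r ^ _) 2, ← Real.rpow_mul h0.le, ← mul_inv, ← pow_succ,
      ← Real.rpow_natCast r (m + 1), ← Real.rpow_neg h0.le]
    congr 1
    push_cast
    ring
  have h3 : (logIter s r ^ (-ε)) ^ 2 = logIter s r ^ (-(2 * ε)) := by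
    rw [← Real.rpow_natCast (logIter s r ^ _) 2, ← Real.rpow_mul h1.le]
    congr 1
    push_cast
    ring
  have h4 : ∏ i ∈ Finset.range s, (Real.sqrt (logIter (i + 1) r))⁻¹ ^ 2
      = ∏ i ∈ Finset.range s, (logIter (i + 1) r)⁻¹ := by
    refine Finset.prod_congr rfl fun i hi => ?_
    rw [inv_pow, Real.sq_sqrt]
    linarith [hr (i + 1) (by have := Finset.mem_range.1 hi; omega)]
  rw [h2, h3, h4]
  ring

theorem summable_radialProfile_sq {s : ℕ} {ε R : ℝ} (hd : 1 ≤ d) (hε : 0 < ε)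
    (hR : ∀ r, R ≤ r → ∀ i ≤ s, 1 ≤ logIter i r) :
    Summable fun n : Lattice d => radialProfile d s ε (max R (latNorm n)) ^ 2 := by
  obtain ⟨m, rfl⟩ : ∃ m, d = m + 1 := ⟨d - 1, by omega⟩
  have hpos : ∀ r, R ≤ r → 0 < r := fun r hr => by
    linarith [hR r hr 0 (Nat.zero_le _), logIter_zero r]
  have hrw : ∀ x : ℝ, radialProfile (m + 1) s ε (max R x) ^ 2
      = (max R x ^ m)⁻¹ * logDensity s (2 * ε) (max R x) := fun x =>
    radialProfile_sq (hR _ (le_max_left _ _))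
  have hld : ∀ x, 0 ≤ logDensity s (2 * ε) (max R x) := fun x =>
    logDensity_nonneg (hR _ (le_max_left _ _))
  have hmp : ∀ x, 0 < max R x := fun x => hpos _ (le_max_left _ _)
  refine summable_of_le_on_shells (fun n => sq_nonneg _)
    (a := fun k => (max R (k + 1 : ℝ) ^ m)⁻¹ * logDensity s (2 * ε) (max R (k + 1 : ℝ)))
    (fun k => mul_nonneg (inv_nonneg.2 (pow_nonneg (hmp _).le _)) (hld _)) (fun k n hn => ?_) ?_
  · rw [hrw]
    have hle : max R (k + 1 : ℝ) ≤ max R (latNorm n) :=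
      max_le_max_left _ (le_latNorm_of_notMem_cube hn)
    refine mul_le_mul ?_ (logDensity_anti (by linarith) (hR _ (le_max_left _ _)) hle) (hld _)
      (inv_nonneg.2 (pow_nonneg (hmp _).le _))
    exact inv_anti₀ (pow_pos (hmp _) _) (pow_le_pow_left₀ (hmp _).le hle _)
  · obtain ⟨K, hK⟩ := exists_nat_ge R
    rw [← summable_nat_add_iff K]
    -- Past R the truncation by `max` is inactive, and (2x+3)/(x+1) ≤ 3 bounds shell growth against
    -- r^(-m) by 3^m.
    refine Summable.of_nonneg_of_le (fun k => ?_) (fun k => ?_)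
      (((summable_nat_add_iff K).2 (summable_logDensity s (a := 2 * ε) (by linarith))).mul_left
        ((3 : ℝ) ^ m))
    · exact mul_nonneg (by positivity)
        (mul_nonneg (inv_nonneg.2 (pow_nonneg (hmp _).le _)) (hld _))
    · have hmax : max R (((k + K : ℕ) : ℝ) + 1) = ((k + K : ℕ) : ℝ) + 1 := by
        refine max_eq_right ?_
        push_cast
        have := Nat.cast_nonneg (α := ℝ) k
        linarith
      have h1 := hld (((k + K : ℕ) : ℝ) + 1)
      rw [hmax] at h1 ⊢
      rw [← mul_assoc]
      refine mul_le_mul_of_nonneg_right ?_ h1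
      set x : ℝ := ((k + K : ℕ) : ℝ) with hx
      have hx0 : 0 ≤ x := Nat.cast_nonneg _
      rw [← div_eq_mul_inv, ← div_pow]
      refine pow_le_pow_left₀ (by positivity) ?_ _
      rw [div_le_iff₀ (by positivity)]
      linarith

/-- If `V` lies below the comparison expression near infinity, then `4d` is an eigenvalue. -/
theorem mem_pointSpec_of_le_comparisonTerm (hd : 1 ≤ d) {V : Lattice d → ℝ}
    (hV : IsCriticalFromAbove V (4 * (d : ℝ))) {s : ℕ} {ε : ℝ} (hε : 0 < ε) {N : ℝ}
    (h : ∀ n : Lattice d, N ≤ latNorm n → V n ≤ 2 * (d : ℝ)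
      - ∑ j : Fin d, comparisonTerm s ε n (n + basisVec j)
      - ∑ j : Fin d, comparisonTerm s ε n (n - basisVec j)) :
    ((4 * (d : ℝ) : ℝ) : ℂ) ∈ pointSpec (schrodinger V) := by
  obtain ⟨R, -, hR⟩ := exists_one_le_logIter s
  -- Clamping the radius at R keeps u positive at every site, including the origin. The exceptional
  -- set reaches up to R + 1, so the neighbours of any remaining site have norm at least R and see
  -- no clamping.
  have hu : ∀ n : Lattice d, 0 < radialProfile d s ε (max R (latNorm n)) := fun n =>
    radialProfile_pos (hR _ (le_max_left _ _))
  refine mem_pointSpec_of_supersolution hV hu (summable_radialProfile_sq hd hε hR)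
    (finite_latNorm_lt (max N (R + 1))).toFinset fun n hn => ?_
  rw [Set.Finite.mem_toFinset, Set.mem_ofPred_eq, not_lt, max_le_iff] at hn
  have h1 := h n hn.1
  have hnR : R ≤ latNorm n := by linarith [hn.2]
  have hcomp : ∀ m : Lattice d, latNorm n - 1 ≤ latNorm m →
      radialProfile d s ε (max R (latNorm m))
        = comparisonTerm s ε n m * radialProfile d s ε (max R (latNorm n)) := by
    intro m hm
    have hmR : R ≤ latNorm m := by linarith [hn.2]
    rw [comparisonTerm_eq (hR _ hnR) (hR _ hmR), max_eq_right hnR, max_eq_right hmR,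
      div_mul_cancel₀ _ (radialProfile_pos (hR _ hnR)).ne']
  rw [flippedOp]
  simp only [hcomp _ (sub_one_le_latNorm_add n _), hcomp _ (sub_one_le_latNorm_sub n _),
    ← add_mul, ← Finset.sum_mul]
  rw [← sub_mul, Finset.sum_add_distrib]
  exact mul_nonneg (by linarith) (hu n).le

end DiscreteSchrodinger

/-! ### Third-order jets with uniform constants -/

namespace DiscreteSchrodinger

/-- `X x = a x + b x² + O(1) x³ + O(x⁴)` near `0`, where all constants are bounded by `M`. -/
def HasJet (M : ℝ) (X : ℝ → ℝ) (a b : ℝ) : Prop :=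
  |a| ≤ M ∧ |b| ≤ M ∧ ∃ c, |c| ≤ M ∧
    ∀ x, |x| ≤ 1 / M → |X x - (a * x + b * x ^ 2 + c * x ^ 3)| ≤ M * x ^ 4

namespace HasJet

variable {M K : ℝ} {X Y : ℝ → ℝ} {a b a' b' : ℝ}

theorem mono (h : HasJet M X a b) (hM : 1 ≤ M) (hK : M ≤ K) : HasJet K X a b := by
  obtain ⟨ha, hb, c, hc, hX⟩ := h
  refine ⟨ha.trans hK, hb.trans hK, c, hc.trans hK, fun x hx => ?_⟩
  refine (hX x (hx.trans (one_div_le_one_div_of_le (by linarith) hK))).trans ?_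
  exact mul_le_mul_of_nonneg_right hK (by positivity)

theorem add (hX : HasJet M X a b) (hY : HasJet M Y a' b') (hM : 1 ≤ M) :
    HasJet (2 * M) (fun x => X x + Y x) (a + a') (b + b') := by
  obtain ⟨ha, hb, c, hc, hX⟩ := hX
  obtain ⟨ha', hb', c', hc', hY⟩ := hY
  refine ⟨(abs_add_le _ _).trans (by linarith), (abs_add_le _ _).trans (by linarith), c + c',
    (abs_add_le _ _).trans (by linarith), fun x hx => ?_⟩
  have hx' : |x| ≤ 1 / M := hx.trans (one_div_le_one_div_of_le (by linarith) (by linarith))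
  have h := (abs_add_le _ _).trans (add_le_add (hX x hx') (hY x hx'))
  refine le_trans (le_of_eq ?_) (h.trans (le_of_eq (by ring)))
  congr 1
  ring

theorem const_mul (hX : HasJet M X a b) (hM : 1 ≤ M) {t : ℝ} (hK : 1 ≤ K) (ht : |t| ≤ K) :
    HasJet (K * M) (fun x => t * X x) (t * a) (t * b) := by
  obtain ⟨ha, hb, c, hc, hX⟩ := hX
  have hmul : ∀ y, |y| ≤ M → |t * y| ≤ K * M := fun y hy => by
    rw [abs_mul]
    exact mul_le_mul ht hy (abs_nonneg _) (by linarith)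
  refine ⟨hmul a ha, hmul b hb, t * c, hmul c hc, fun x hx => ?_⟩
  have hx' : |x| ≤ 1 / M := hx.trans (one_div_le_one_div_of_le (by linarith) (by nlinarith))
  have h := mul_le_mul ht (hX x hx') (abs_nonneg _) (by linarith : (0 : ℝ) ≤ K)
  rw [← abs_mul] at h
  refine le_trans (le_of_eq ?_) (h.trans (le_of_eq (by ring)))
  congr 1
  ring

/-- L allows the perturbation estimate to hold only on a smaller interval; it is added to the
constant to shrink the radius. -/
theorem of_remainder (hX : HasJet M X a b) (hM : 1 ≤ M) {L : ℝ} (hK : 0 ≤ K) (hL : 0 < L)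
    (h : ∀ x, |x| ≤ 1 / L → |Y x - X x| ≤ K * x ^ 4) : HasJet (M + K + L) Y a b := by
  obtain ⟨ha, hb, c, hc, hX⟩ := hX
  refine ⟨by linarith, by linarith, c, by linarith, fun x hx => ?_⟩
  have h1 := hX x (hx.trans (one_div_le_one_div_of_le (by linarith) (by linarith)))
  have h2 := h x (hx.trans (one_div_le_one_div_of_le hL (by linarith)))
  have h3 := (abs_add_le _ _).trans (add_le_add h2 h1)
  have h4 : 0 ≤ L * x ^ 4 := by positivity
  refine le_trans (le_of_eq ?_) (h3.trans (by linarith))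
  congr 1
  ring

theorem abs_le_one (hM : 1 ≤ M) {x : ℝ} (hx : |x| ≤ 1 / M) : |x| ≤ 1 :=
  hx.trans (by rw [div_le_one (by linarith)]; exact hM)

theorem abs_poly_le {a b c x : ℝ} (ha : |a| ≤ M) (hb : |b| ≤ M) (hc : |c| ≤ M) (hx : |x| ≤ 1) :
    |a * x + b * x ^ 2 + c * x ^ 3| ≤ 3 * M * |x| := by
  have hx0 := abs_nonneg x
  have hM : 0 ≤ M := (abs_nonneg a).trans ha
  have h2 : |x| ^ 2 ≤ |x| := pow_le_of_le_one hx0 hx (by norm_num)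
  have h3 : |x| ^ 3 ≤ |x| := pow_le_of_le_one hx0 hx (by norm_num)
  have e1 : |a * x| ≤ M * |x| := by rw [abs_mul]; gcongr
  have e2 : |b * x ^ 2| ≤ M * |x| := by rw [abs_mul, abs_pow]; gcongr
  have e3 : |c * x ^ 3| ≤ M * |x| := by rw [abs_mul, abs_pow]; gcongr
  have := abs_add_three (a * x) (b * x ^ 2) (c * x ^ 3)
  linarith

theorem abs_le (hX : HasJet M X a b) (hM : 1 ≤ M) {x : ℝ} (hx : |x| ≤ 1 / M) :
    |X x| ≤ 4 * M * |x| := by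
  obtain ⟨ha, hb, c, hc, hX⟩ := hX
  have hx1 := abs_le_one hM hx
  have h1 := hX x hx
  have h2 := abs_poly_le ha hb hc hx1
  have h4 : x ^ 4 ≤ |x| := by
    rw [← abs_of_nonneg (show (0 : ℝ) ≤ x ^ 4 by positivity), abs_pow]
    exact pow_le_of_le_one (abs_nonneg x) hx1 (by norm_num)
  have h5 : M * x ^ 4 ≤ M * |x| := mul_le_mul_of_nonneg_left h4 (by linarith)
  have h6 := abs_sub_abs_le_abs_sub (X x) (a * x + b * x ^ 2 + c * x ^ 3)
  linarith

/-- With p and p' the cubic polynomials, the error is (X - p)Y + p(Y - p') plus the terms of p p' of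
degree at least 4; these contribute 4, 3 and 6, hence the 13. -/
theorem mul (hX : HasJet M X a b) (hY : HasJet M Y a' b') (hM : 1 ≤ M) :
    HasJet (13 * M ^ 2) (fun x => X x * Y x) 0 (a * a') := by
  have hYle := fun x hx => hY.abs_le hM (x := x) hx
  obtain ⟨ha, hb, c, hc, hX⟩ := hX
  obtain ⟨ha', hb', c', hc', hY⟩ := hY
  have hM0 : 0 ≤ M := by linarith
  have hmul : ∀ {y z}, |y| ≤ M → |z| ≤ M → |y * z| ≤ M ^ 2 := fun {y z} hy hz => by
    rw [abs_mul, sq]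
    exact mul_le_mul hy hz (abs_nonneg _) hM0
  have hM2 : 0 ≤ M ^ 2 := by positivity
  refine ⟨by rw [abs_zero]; positivity, (hmul ha ha').trans (by linarith), a * b' + b * a',
    (abs_add_le _ _).trans (by linarith [hmul ha hb', hmul hb ha']), fun x hx => ?_⟩
  have hx' : |x| ≤ 1 / M := hx.trans (one_div_le_one_div_of_le (by linarith) (by nlinarith))
  have hx1 := abs_le_one hM hx'
  set p := a * x + b * x ^ 2 + c * x ^ 3 with hp
  set p' := a' * x + b' * x ^ 2 + c' * x ^ 3 with hp'
  have hx4 : (0 : ℝ) ≤ x ^ 4 := by positivity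
  have e1 : |(X x - p) * Y x| ≤ 4 * M ^ 2 * x ^ 4 := by
    rw [abs_mul]
    have h1 : |Y x| ≤ 4 * M := (hYle x hx').trans (by nlinarith)
    calc _ ≤ (M * x ^ 4) * (4 * M) := mul_le_mul (hX x hx') h1 (abs_nonneg _) (by positivity)
      _ = _ := by ring
  have e2 : |p * (Y x - p')| ≤ 3 * M ^ 2 * x ^ 4 := by
    rw [abs_mul]
    have h1 : |p| ≤ 3 * M := (abs_poly_le ha hb hc hx1).trans (by nlinarith)
    calc _ ≤ (3 * M) * (M * x ^ 4) := mul_le_mul h1 (hY x hx') (abs_nonneg _) (by positivity)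
      _ = _ := by ring
  have e3 : |(a * c' + b * b' + c * a') + (b * c' + c * b') * x + c * c' * x ^ 2| ≤ 6 * M ^ 2 := by
    have f1 : |a * c' + b * b' + c * a'| ≤ 3 * M ^ 2 :=
      (abs_add_three _ _ _).trans (by linarith [hmul ha hc', hmul hb hb', hmul hc ha'])
    have f2 : |(b * c' + c * b') * x| ≤ 2 * M ^ 2 := by
      rw [abs_mul]
      calc _ ≤ (2 * M ^ 2) * 1 := mul_le_mul
            ((abs_add_le _ _).trans (by linarith [hmul hb hc', hmul hc hb'])) hx1
            (abs_nonneg _) (by positivity)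
        _ = _ := by ring
    have f3 : |c * c' * x ^ 2| ≤ M ^ 2 := by
      rw [abs_mul, abs_pow]
      calc _ ≤ M ^ 2 * 1 := mul_le_mul (hmul hc hc') (pow_le_one₀ (abs_nonneg x) hx1)
            (by positivity) (by positivity)
        _ = _ := by ring
    exact (abs_add_three _ _ _).trans (by linarith)
  have e4 : |((a * c' + b * b' + c * a') + (b * c' + c * b') * x + c * c' * x ^ 2) * x ^ 4|
      ≤ 6 * M ^ 2 * x ^ 4 := by
    rw [abs_mul, abs_of_nonneg hx4]
    exact mul_le_mul_of_nonneg_right e3 hx4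
  have hsum := (abs_add_three ((X x - p) * Y x) (p * (Y x - p'))
    (((a * c' + b * b' + c * a') + (b * c' + c * b') * x + c * c' * x ^ 2) * x ^ 4))
  refine le_trans (le_of_eq ?_) (hsum.trans (by linarith))
  congr 1
  rw [hp, hp']
  ring

/-- Substitute the jet of X into the cubic of F; since X = O(x), the remainder of F is O(x⁴). K is
chosen before the functions, which gives uniformity in the logarithms. -/
theorem comp (C M : ℝ) (hC : 1 ≤ C) (hM : 1 ≤ M) : ∃ K, 1 ≤ K ∧
    ∀ (F : ℝ → ℝ) (f₁ f₂ : ℝ) (X : ℝ → ℝ) (a b : ℝ), HasJet C F f₁ f₂ → HasJet M X a b →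
      HasJet K (fun x => F (X x)) (f₁ * a) (f₁ * b + f₂ * a ^ 2) := by
  set M₂ := 13 * M ^ 2 with hM₂
  have h12 : M ≤ M₂ := by nlinarith
  have hM₂1 : 1 ≤ M₂ := hM.trans h12
  set M₃ := 13 * M₂ ^ 2 with hM₃
  have h23 : M₂ ≤ M₃ := by nlinarith
  have hM₃1 : 1 ≤ M₃ := hM₂1.trans h23
  set M₄ := 4 * (C * M₃) with hM₄
  have hCM : 1 ≤ C * M₃ := by nlinarith
  have hM₄1 : 1 ≤ M₄ := by linarith
  have hR : 0 ≤ C * (4 * M) ^ 4 := by positivity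
  have hL : 0 < 4 * M * C := by positivity
  refine ⟨M₄ + C * (4 * M) ^ 4 + 4 * M * C, by linarith, fun F f₁ f₂ X a b hF hX => ?_⟩
  obtain ⟨hf₁, hf₂, f₃, hf₃, hF⟩ := hF
  have j2 := hX.mul hX hM
  have j3 := (hX.mono hM h12).mul j2 hM₂1
  have k1 := (hX.mono hM (h12.trans h23)).const_mul hM₃1 hC hf₁
  have k2 := (j2.mono hM₂1 h23).const_mul hM₃1 hC hf₂
  have k3 := j3.const_mul hM₃1 hC hf₃
  have k := ((k1.add k2 hCM).add (k3.mono hCM (by linarith : C * M₃ ≤ 2 * (C * M₃)))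
    (by linarith))
  have k' : HasJet M₄ (fun x => f₁ * X x + f₂ * (X x * X x) + f₃ * (X x * (X x * X x)))
      (f₁ * a) (f₁ * b + f₂ * a ^ 2) := by
    convert k using 1 <;> ring
  refine k'.of_remainder hM₄1 hR hL fun x hx => ?_
  have hx' : |x| ≤ 1 / M := hx.trans (one_div_le_one_div_of_le (by linarith) (by nlinarith))
  have h1 := hX.abs_le hM hx'
  have h2 : |X x| ≤ 1 / C := by
    refine h1.trans ?_
    rw [le_div_iff₀ (by positivity)] at hx ⊢
    linarith
  have h3 := hF (X x) h2
  have h4 : X x ^ 4 ≤ (4 * M) ^ 4 * x ^ 4 := by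
    have h5 := pow_le_pow_left₀ (abs_nonneg _) h1 4
    rw [mul_pow, Even.pow_abs (by decide), Even.pow_abs (by decide)] at h5
    exact h5
  have h5 := mul_le_mul_of_nonneg_left h4 (by linarith : (0 : ℝ) ≤ C)
  refine le_trans (le_of_eq ?_) (h3.trans (h5.trans (le_of_eq (by ring))))
  congr 1
  ring

theorem sum_range (s : ℕ) (M : ℝ) (hM : 1 ≤ M) : ∃ K, 1 ≤ K ∧
    ∀ (X : ℕ → ℝ → ℝ) (a b : ℕ → ℝ), (∀ i < s, HasJet M (X i) (a i) (b i)) →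
      HasJet K (fun x => ∑ i ∈ Finset.range s, X i x) (∑ i ∈ Finset.range s, a i)
        (∑ i ∈ Finset.range s, b i) := by
  induction s with
  | zero =>
    refine ⟨1, le_rfl, fun X a b _ => ⟨by simp, by simp, 0, by simp, fun x _ => ?_⟩⟩
    simp
    positivity
  | succ s ih =>
    obtain ⟨K, hK, h⟩ := ih
    refine ⟨2 * max K M, by linarith [le_max_left K M], fun X a b hX => ?_⟩
    simp only [Finset.sum_range_succ]
    exact ((h X a b fun i hi => hX i (by omega)).mono hK (le_max_left _ _)).add
      ((hX s (by omega)).mono hM (le_max_right _ _)) (hK.trans (le_max_left _ _))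

end HasJet

theorem hasJet_log : HasJet 2 (fun x => Real.log (1 + x)) 1 (-1 / 2) := by
  refine ⟨by norm_num, by norm_num [abs_le], 1 / 3, by norm_num [abs_le], fun x hx => ?_⟩
  have hx1 : |-x| < 1 := by rw [abs_neg]; linarith
  have h := Real.abs_log_sub_add_sum_range_le hx1 3
  rw [abs_neg] at h
  have h2 : |x| ^ (3 + 1) / (1 - |x|) ≤ 2 * x ^ 4 := by
    rw [Even.pow_abs (by decide), div_le_iff₀ (by linarith)]
    have h3 : 0 ≤ x ^ 4 * (1 - 2 * |x|) := mul_nonneg (by positivity) (by linarith)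
    have h4 : x ^ (3 + 1) = x ^ 4 := rfl
    linarith
  refine le_trans (le_of_eq ?_) (h.trans h2)
  congr 1
  simp [Finset.sum_range_succ]
  ring

theorem hasJet_exp : HasJet 2 (fun x => Real.exp x - 1) 1 (1 / 2) := by
  refine ⟨by norm_num, by norm_num [abs_le], 1 / 6, by norm_num [abs_le], fun x hx => ?_⟩
  have h := Real.exp_bound (x := x) (by linarith) (n := 4) (by norm_num)
  rw [Even.pow_abs (by decide)] at h
  have h2 : x ^ 4 * (((4 : ℕ).succ : ℝ) / (((4 : ℕ).factorial : ℝ) * (4 : ℕ))) ≤ 2 * x ^ 4 := by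
    have : (0 : ℝ) ≤ x ^ 4 := by positivity
    norm_num [Nat.factorial]
    linarith
  refine le_trans (le_of_eq ?_) (h.trans h2)
  congr 1
  simp [Finset.sum_range_succ, Nat.factorial]
  ring

/-- The functions with `logRatio α i δ = log (log_i |m| / log_i |n|)` when `|m|² = |n|² (1 + δ)`
and `α k = 1 / log_k |n|`. -/
noncomputable def logRatio (α : ℕ → ℝ) : ℕ → ℝ → ℝ
  | 0, x => 1 / 2 * Real.log (1 + x)
  | i + 1, x => Real.log (1 + α (i + 1) * logRatio α i x)

theorem prod_range_mem_Icc {α : ℕ → ℝ} {i : ℕ} (hα : ∀ k < i, 0 ≤ α (k + 1) ∧ α (k + 1) ≤ 1) :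
    0 ≤ ∏ k ∈ Finset.range i, α (k + 1) ∧ ∏ k ∈ Finset.range i, α (k + 1) ≤ 1 :=
  ⟨Finset.prod_nonneg fun k hk => (hα k (Finset.mem_range.1 hk)).1,
    Finset.prod_le_one (fun k hk => (hα k (Finset.mem_range.1 hk)).1)
      fun k hk => (hα k (Finset.mem_range.1 hk)).2⟩

theorem prod_range_succ_le {α : ℕ → ℝ} {i : ℕ}
    (hα : ∀ k < i + 1, 0 ≤ α (k + 1) ∧ α (k + 1) ≤ 1) :
    ∏ k ∈ Finset.range (i + 1), α (k + 1) ≤ α 1 := by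
  rw [Finset.prod_range_succ']
  have h : ∏ k ∈ Finset.range i, α (k + 1 + 1) ≤ 1 :=
    Finset.prod_le_one (fun k hk => (hα (k + 1) (by have := Finset.mem_range.1 hk; omega)).1)
      fun k hk => (hα (k + 1) (by have := Finset.mem_range.1 hk; omega)).2
  have h0 := (hα 0 (by omega)).1
  simpa using mul_le_mul_of_nonneg_right h h0

/-- With P the product of the first i values of α, the coefficients P/2 and -P/4 come from
multiplying those of log(1+x)/2 by α at each level. The quadratic term of the outer logarithm adds
-(P α_{i+1})²/8, at most α_1² in size; accumulating these gives e. M does not depend on α. -/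
theorem hasJet_logRatio (i : ℕ) : ∃ M, 1 ≤ M ∧ ∀ α : ℕ → ℝ,
    (∀ k < i, 0 ≤ α (k + 1) ∧ α (k + 1) ≤ 1) → ∃ e, |e| ≤ i * α 1 ^ 2 ∧
      HasJet M (logRatio α i) ((∏ k ∈ Finset.range i, α (k + 1)) / 2)
        (-(∏ k ∈ Finset.range i, α (k + 1)) / 4 + e) := by
  induction i with
  | zero =>
    refine ⟨1 * 2, by norm_num, fun α _ => ⟨0, by simp, ?_⟩⟩
    have h := hasJet_log.const_mul (by norm_num) (t := 1 / 2) le_rfl (by norm_num [abs_le])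
    change HasJet _ (fun x => 1 / 2 * Real.log (1 + x)) _ _
    convert h using 1 <;> norm_num
  | succ i ih =>
    obtain ⟨M, hM, h⟩ := ih
    obtain ⟨K, hK, hcomp⟩ := HasJet.comp 2 (1 * M) (by norm_num) (by linarith)
    refine ⟨K, hK, fun α hα => ?_⟩
    obtain ⟨e, he, hj⟩ := h α fun k hk => hα k (by omega)
    have hα' := hα i (by omega)
    have h1 := hcomp _ _ _ _ _ _ hasJet_log
      (hj.const_mul hM le_rfl (t := α (i + 1)) (abs_le.2 ⟨by linarith, hα'.2⟩))
    set P := ∏ k ∈ Finset.range i, α (k + 1) with hP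
    have hP' : ∏ k ∈ Finset.range (i + 1), α (k + 1) = P * α (i + 1) :=
      Finset.prod_range_succ _ _
    have hPle := prod_range_succ_le hα
    have hP0 := (prod_range_mem_Icc hα).1
    rw [hP'] at hPle hP0 ⊢
    refine ⟨α (i + 1) * e - (P * α (i + 1)) ^ 2 / 8, ?_, ?_⟩
    · have e1 : |α (i + 1) * e| ≤ i * α 1 ^ 2 := by
        rw [abs_mul, abs_of_nonneg hα'.1]
        calc _ ≤ 1 * |e| := mul_le_mul_of_nonneg_right hα'.2 (abs_nonneg _)
          _ ≤ _ := by linarith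
      have e2 : (P * α (i + 1)) ^ 2 ≤ α 1 ^ 2 := pow_le_pow_left₀ hP0 hPle 2
      have e3 : |(P * α (i + 1)) ^ 2 / 8| ≤ α 1 ^ 2 := by
        rw [abs_of_nonneg (by positivity)]
        have : 0 ≤ (P * α (i + 1)) ^ 2 := by positivity
        linarith
      refine (abs_sub _ _).trans ?_
      push_cast
      linarith
    · change HasJet _ (fun x => Real.log (1 + α (i + 1) * logRatio α i x)) _ _
      convert h1 using 1 <;> ring

end DiscreteSchrodinger

/-! ### Expansion of the comparison terms and the explicit decay condition -/

namespace DiscreteSchrodinger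

open Filter Topology Asymptotics

variable {d : ℕ}

/-- The logarithm of the comparison term as a function of the relative increment of `|n|²`. -/
noncomputable def logComparison (d s : ℕ) (ε : ℝ) (α : ℕ → ℝ) (x : ℝ) : ℝ :=
  (d / 2 : ℝ) * logRatio α 0 x + (1 / 2 * ∑ i ∈ Finset.range s, logRatio α (i + 1) x
    + ε * logRatio α s x)

/-- The quantity `∑_{j=1}^s ∏_{k ≤ j} α_k + 2 ε ∏_{k ≤ s} α_k`. -/
noncomputable def logWeight (s : ℕ) (ε : ℝ) (α : ℕ → ℝ) : ℝ :=
  ∑ i ∈ Finset.range s, ∏ k ∈ Finset.range (i + 1), α (k + 1)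
    + 2 * ε * ∏ k ∈ Finset.range s, α (k + 1)

/-- The logarithm of the comparison term has linear coefficient -(d + W)/4, and exponentiation adds
half its square, (d + W)²/32, to the quadratic coefficient. The error e collects those of
`hasJet_logRatio`. -/
theorem hasJet_comparison (d s : ℕ) {ε : ℝ} (hε : 0 < ε) : ∃ M, 1 ≤ M ∧ ∀ α : ℕ → ℝ,
    (∀ k < s, 0 ≤ α (k + 1) ∧ α (k + 1) ≤ 1) → ∃ e, |e| ≤ (s ^ 2 + ε * s) * α 1 ^ 2 ∧
      HasJet M (fun x => Real.exp (-1 * logComparison d s ε α x) - 1)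
        (-(d + logWeight s ε α) / 4)
        ((d + logWeight s ε α) / 8 + (d + logWeight s ε α) ^ 2 / 32 + e) := by
  choose M hM h using hasJet_logRatio
  set N := ∑ i ∈ Finset.range (s + 1), M i with hN
  have hMN : ∀ i ≤ s, M i ≤ N := fun i hi =>
    Finset.single_le_sum (f := M) (fun j _ => by linarith [hM j])
      (Finset.mem_range.2 (by omega))
  have hN1 : 1 ≤ N := (hM 0).trans (hMN 0 (Nat.zero_le _))
  obtain ⟨K, hK, hsum⟩ := HasJet.sum_range s N hN1
  set T := max K N with hT
  have hT1 : 1 ≤ T := hK.trans (le_max_left _ _)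
  set c := 1 + d / 2 + ε with hc
  have hc1 : 1 ≤ c := by
    have : (0 : ℝ) ≤ d := Nat.cast_nonneg d
    linarith
  have hcT : 1 ≤ c * T := by nlinarith
  obtain ⟨Q, hQ, hcomp⟩ := HasJet.comp 2 (1 * (2 * (2 * (c * T)))) (by norm_num) (by linarith)
  refine ⟨Q, hQ, fun α hα => ?_⟩
  have hex : ∀ i, ∃ e, i ≤ s → |e| ≤ i * α 1 ^ 2 ∧
      HasJet (M i) (logRatio α i) ((∏ k ∈ Finset.range i, α (k + 1)) / 2)
        (-(∏ k ∈ Finset.range i, α (k + 1)) / 4 + e) := by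
    intro i
    by_cases hi : i ≤ s
    · obtain ⟨e, he⟩ := h i α fun k hk => hα k (by omega)
      exact ⟨e, fun _ => he⟩
    · exact ⟨0, fun hi' => absurd hi' hi⟩
  choose e he using hex
  have hj : ∀ i ≤ s, HasJet N (logRatio α i) ((∏ k ∈ Finset.range i, α (k + 1)) / 2)
      (-(∏ k ∈ Finset.range i, α (k + 1)) / 4 + e i) := fun i hi =>
    (he i hi).2.mono (hM i) (hMN i hi)
  have hd0 : (0 : ℝ) ≤ d := Nat.cast_nonneg d
  have j0 := (((he 0 (Nat.zero_le _)).2.mono (hM 0) (hMN 0 (Nat.zero_le _))).mono hN1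
    (le_max_right K N)).const_mul hT1 (t := (d / 2 : ℝ)) hc1
    (by rw [abs_of_nonneg (by positivity)]; linarith)
  have jS := ((hsum (fun i => logRatio α (i + 1)) _ _ fun i hi => hj (i + 1) (by omega)).mono hK
    (le_max_left K N)).const_mul hT1 (t := 1 / 2) hc1
    (by rw [abs_of_nonneg (by positivity)]; linarith)
  have js := ((hj s le_rfl).mono hN1 (le_max_right K N)).const_mul hT1 (t := ε) hc1
    (by rw [abs_of_nonneg hε.le]; linarith)
  have j := ((j0.mono hcT (by linarith : c * T ≤ 2 * (c * T))).add (jS.add js hcT) (by linarith))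
    |>.const_mul (by linarith) (t := -1) le_rfl (by norm_num)
  have hfin := hcomp _ _ _ _ _ _ hasJet_exp j
  have he0 : e 0 = 0 := by
    have := (he 0 (Nat.zero_le _)).1
    simpa using this
  refine ⟨-(1 / 2 * ∑ i ∈ Finset.range s, e (i + 1) + ε * e s), ?_, ?_⟩
  · rw [abs_neg]
    refine (abs_add_le _ _).trans ?_
    rw [abs_mul, abs_mul, abs_of_nonneg hε.le, abs_of_nonneg (by norm_num : (0 : ℝ) ≤ 1 / 2)]
    have h1 : |∑ i ∈ Finset.range s, e (i + 1)| ≤ s ^ 2 * α 1 ^ 2 := by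
      refine (Finset.abs_sum_le_sum_abs _ _).trans ?_
      refine (Finset.sum_le_card_nsmul _ _ (s * α 1 ^ 2) fun i hi => ?_).trans (le_of_eq ?_)
      · have hi' := Finset.mem_range.1 hi
        refine ((he (i + 1) (by omega)).1).trans (mul_le_mul_of_nonneg_right ?_ (sq_nonneg _))
        exact_mod_cast hi'
      · rw [Finset.card_range, nsmul_eq_mul]; ring
    have h2 := mul_le_mul_of_nonneg_left (he s le_rfl).1 hε.le
    have h3 : 0 ≤ (s : ℝ) ^ 2 * α 1 ^ 2 := by positivity
    linarith
  · convert hfin using 1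
    · rfl
    · simp only [logWeight, Finset.prod_range_zero, ← Finset.sum_div]
      ring
    · simp only [logWeight, Finset.prod_range_zero, ← Finset.sum_div, Finset.sum_add_distrib, he0,
        Finset.sum_neg_distrib]
      ring

/-- Summing a jet over the increments of `|n|²` along the nearest neighbours of `n`. -/
theorem sum_jet_le {M a b : ℝ} {E : ℝ → ℝ} (hE : HasJet M E a b) (hM : 1 ≤ M) (n : Lattice d)
    (hn : 3 * M ≤ latNorm n) :
    ∑ j : Fin d, (E ((1 + 2 * n j) / latNorm n ^ 2) + E ((1 - 2 * n j) / latNorm n ^ 2))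
      ≤ (2 * d * a + 8 * b) / latNorm n ^ 2 + 190 * d * M / (latNorm n ^ 2) ^ 2 := by
  obtain ⟨-, hb, c, hc, hE⟩ := hE
  set r := latNorm n with hr
  have hr3 : 3 ≤ r := by linarith
  have hr0 : 0 < r := by linarith
  set t := r ^ 2 with ht
  have ht0 : 0 < t := by positivity
  have ht1 : 1 ≤ t := by nlinarith
  -- Opposite neighbours cancel to leading order in odd degrees: linear terms sum to 2/t, and cubes
  -- to (2 + 24 n_j²)/t³ = O(1/t²). Thus the cubic coefficient need only be bounded. The main
  -- quadratic part is 8 n_j²/t², and Σ n_j² = t makes it 8b/t after summation. As |x| ≤ 3/r, fourth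
  -- powers are at most 81/t².
  have hterm : ∀ j : Fin d, E ((1 + 2 * n j) / t) + E ((1 - 2 * n j) / t)
      ≤ 2 * a / t + 8 * b * (n j : ℝ) ^ 2 / t ^ 2 + 190 * M / t ^ 2 := by
    intro j
    have hnj := abs_apply_le_latNorm n j
    have hsmall : ∀ x : ℝ, |x| ≤ 1 + 2 * r → |x / t| ≤ 1 / M ∧ (x / t) ^ 4 ≤ 81 / t ^ 2 := by
      intro x hx
      have h1 : |x / t| ≤ 3 / r := by
        rw [abs_div, abs_of_pos ht0, div_le_div_iff₀ ht0 hr0, ht]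
        nlinarith [abs_nonneg x]
      refine ⟨h1.trans ?_, ?_⟩
      · rw [div_le_div_iff₀ hr0 (by linarith)]
        linarith
      · have h2 := pow_le_pow_left₀ (abs_nonneg _) h1 4
        rw [Even.pow_abs (by decide)] at h2
        refine h2.trans (le_of_eq ?_)
        rw [ht, div_pow]
        norm_num [← pow_mul]
    have hn1 : |(n j : ℝ)| ≤ r := hnj
    have hp := hsmall (1 + 2 * n j) (by
      refine (abs_add_le _ _).trans ?_
      rw [abs_one, abs_mul, abs_two]
      linarith)
    have hm := hsmall (1 - 2 * n j) (by
      refine (abs_sub _ _).trans ?_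
      rw [abs_one, abs_mul, abs_two]
      linarith)
    have e1 := (abs_le.1 (hE _ hp.1)).2
    have e2 := (abs_le.1 (hE _ hm.1)).2
    have e3 := mul_le_mul_of_nonneg_left hp.2 (by linarith : (0 : ℝ) ≤ M)
    have e4 := mul_le_mul_of_nonneg_left hm.2 (by linarith : (0 : ℝ) ≤ M)
    have hnt : (n j : ℝ) ^ 2 ≤ t := by
      rw [ht, ← sq_abs]
      exact pow_le_pow_left₀ (abs_nonneg _) hn1 2
    have e5 : c * ((2 + 24 * (n j : ℝ) ^ 2) / t ^ 3) ≤ 26 * M / t ^ 2 := by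
      have h1 : (2 + 24 * (n j : ℝ) ^ 2) / t ^ 3 ≤ 26 / t ^ 2 := by
        rw [div_le_div_iff₀ (by positivity) (by positivity)]
        have : 0 ≤ t ^ 2 * (26 * t - (2 + 24 * (n j : ℝ) ^ 2)) :=
          mul_nonneg (by positivity) (by linarith)
        nlinarith
      calc _ ≤ M * (26 / t ^ 2) := mul_le_mul ((le_abs_self c).trans hc) h1 (by positivity)
            (by linarith)
        _ = _ := by ring
    have e6 : b * (2 / t ^ 2) ≤ M * (2 / t ^ 2) :=
      mul_le_mul_of_nonneg_right ((le_abs_self b).trans hb) (by positivity)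
    have e7 : a * ((1 + 2 * n j) / t) + b * ((1 + 2 * n j) / t) ^ 2 + c * ((1 + 2 * n j) / t) ^ 3
        + (a * ((1 - 2 * n j) / t) + b * ((1 - 2 * n j) / t) ^ 2 + c * ((1 - 2 * n j) / t) ^ 3)
        = 2 * a / t + 8 * b * (n j : ℝ) ^ 2 / t ^ 2 + b * (2 / t ^ 2)
          + c * ((2 + 24 * (n j : ℝ) ^ 2) / t ^ 3) := by
      field_simp
      ring
    have e8 : 190 * M / t ^ 2 = M * (81 / t ^ 2) + M * (81 / t ^ 2) + 26 * M / t ^ 2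
        + M * (2 / t ^ 2) := by ring
    linarith
  refine (Finset.sum_le_sum fun j _ => hterm j).trans (le_of_eq ?_)
  have hs : ∑ j, 8 * b * (n j : ℝ) ^ 2 / t ^ 2 = 8 * b * latNorm n ^ 2 / t ^ 2 := by
    rw [← Finset.sum_div, ← Finset.mul_sum, ← latNorm_sq]
  rw [Finset.sum_add_distrib, Finset.sum_add_distrib, hs, ← hr, ← ht, Finset.sum_const,
    Finset.sum_const, Finset.card_univ, Fintype.card_fin, nsmul_eq_mul, nsmul_eq_mul]
  field_simp

/-- log_{i+1}|m| / log_{i+1}|n| = 1 + α_{i+1} log(log_i|m| / log_i|n|), which is the recursion of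
`logRatio`. -/
theorem log_logIter_div {s : ℕ} {x y δ : ℝ} (hx : ∀ i ≤ s, 1 ≤ logIter i x)
    (hy : ∀ i ≤ s, 1 ≤ logIter i y) (h : y ^ 2 = x ^ 2 * (1 + δ)) : ∀ i ≤ s,
    Real.log (logIter i y / logIter i x) = logRatio (fun k => 1 / logIter k x) i δ := by
  intro i
  induction i with
  | zero =>
    intro _
    have hx0 : 0 < x := by linarith [hx 0 (Nat.zero_le _), logIter_zero x]
    have h1 : 1 + δ = (y / x) ^ 2 := by
      rw [div_pow, h]
      field_simp
    rw [logRatio, logIter_zero, logIter_zero, h1, Real.log_pow]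
    push_cast
    ring
  | succ i ih =>
    intro hi
    have hxi : 0 < logIter i x := by linarith [hx i (by omega)]
    have hyi : 0 < logIter i y := by linarith [hy i (by omega)]
    have hx1 : 0 < logIter (i + 1) x := by linarith [hx (i + 1) hi]
    rw [logRatio, ← ih (by omega), Real.log_div hyi.ne' hxi.ne', ← logIter_succ, ← logIter_succ]
    congr 1
    field_simp
    ring

theorem comparisonTerm_eq_exp {s : ℕ} {ε δ : ℝ} {n m : Lattice d}
    (hn : ∀ i ≤ s, 1 ≤ logIter i (latNorm n)) (hm : ∀ i ≤ s, 1 ≤ logIter i (latNorm m))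
    (h : latNorm m ^ 2 = latNorm n ^ 2 * (1 + δ)) :
    comparisonTerm s ε n m
      = Real.exp (-1 * logComparison d s ε (fun k => 1 / logIter k (latNorm n)) δ) := by
  have key := log_logIter_div hn hm h
  have hpos : ∀ i ≤ s, 0 < logIter i (latNorm n) / logIter i (latNorm m) := fun i hi =>
    div_pos (by linarith [hn i hi]) (by linarith [hm i hi])
  have hlog : ∀ i ≤ s, Real.log (logIter i (latNorm n) / logIter i (latNorm m))
      = -logRatio (fun k => 1 / logIter k (latNorm n)) i δ := fun i hi => by
    rw [← key i hi, ← Real.log_inv, inv_div]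
  have h0 := hlog 0 (Nat.zero_le _)
  have hp0 := hpos 0 (Nat.zero_le _)
  rw [logIter_zero, logIter_zero] at h0 hp0
  rw [comparisonTerm, Real.rpow_def_of_pos hp0, Real.rpow_def_of_pos (hpos s le_rfl), h0,
    hlog s le_rfl, prod_Icc_one_eq]
  have hprod : ∏ i ∈ Finset.range s,
      Real.sqrt (logIter (i + 1) (latNorm n) / logIter (i + 1) (latNorm m))
      = Real.exp (∑ i ∈ Finset.range s,
        -logRatio (fun k => 1 / logIter k (latNorm n)) (i + 1) δ * (1 / 2)) := by
    rw [Real.exp_sum]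
    refine Finset.prod_congr rfl fun i hi => ?_
    have hi' : i + 1 ≤ s := by have := Finset.mem_range.1 hi; omega
    rw [Real.sqrt_eq_rpow, Real.rpow_def_of_pos (hpos _ hi'), hlog _ hi']
  rw [hprod, ← Real.exp_add, ← Real.exp_add, logComparison, ← Finset.sum_mul,
    Finset.sum_neg_distrib]
  congr 1
  ring

/-- Replacing r by log r in the inductive hypothesis makes the longer product o((log r)²), hence
o(r). -/
theorem isLittleO_prod_logIter (s : ℕ) :
    (fun r => ∏ k ∈ Finset.range s, logIter (k + 1) r) =o[atTop] (id : ℝ → ℝ) := by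
  induction s with
  | zero => simpa using isLittleO_const_id_atTop (1 : ℝ)
  | succ s ih =>
    have h : (fun r => ∏ k ∈ Finset.range (s + 1), logIter (k + 1) r)
        = fun r => (∏ k ∈ Finset.range s, logIter (k + 1) (Real.log r)) * Real.log r := by
      funext r
      rw [Finset.prod_range_succ']
      rfl
    rw [h]
    have h1 : (fun r => (∏ k ∈ Finset.range s, logIter (k + 1) (Real.log r)) * Real.log r)
        =o[atTop] fun r => Real.log r * Real.log r :=
      (ih.comp_tendsto Real.tendsto_log_atTop).mul_isBigO (isBigO_refl _ _)
    refine h1.trans ?_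
    simpa only [sq] using (Real.isLittleO_pow_log_id_atTop (n := 2))

theorem eventually_prod_logIter_le (s : ℕ) {η : ℝ} (hη : 0 < η) :
    ∀ᶠ r in atTop, ∏ k ∈ Finset.range s, logIter (k + 1) r ≤ η * r := by
  filter_upwards [(isLittleO_prod_logIter s).def hη, eventually_ge_atTop 0] with r hr hr0
  rw [id, Real.norm_of_nonneg hr0] at hr
  exact (le_abs_self _).trans hr

theorem eventually_inv_sq_le (s : ℕ) {η : ℝ} (hη : 0 < η) :
    ∀ᶠ r in atTop, 1 / r ^ 2 ≤ η * ∏ k ∈ Finset.range s, 1 / logIter (k + 1) r := by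
  filter_upwards [eventually_prod_logIter_le s hη, eventually_ge_atTop 1,
    eventually_one_le_logIter s] with r hr hr1 hl
  have hp : 0 < ∏ k ∈ Finset.range s, logIter (k + 1) r := Finset.prod_pos fun k hk => by
    linarith [hl (k + 1) (by have := Finset.mem_range.1 hk; omega)]
  rw [Finset.prod_div_distrib, Finset.prod_const_one, mul_one_div,
    div_le_div_iff₀ (by positivity) hp]
  nlinarith

/-- After cancelling one factor 1/log r this is the bound on products of iterated logarithms taken
at log r. -/
theorem eventually_inv_log_sq_le (s : ℕ) {η : ℝ} (hη : 0 < η) :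
    ∀ᶠ r in atTop, (1 / logIter 1 r) ^ 2
      ≤ η * ∏ k ∈ Finset.range (s + 1), 1 / logIter (k + 1) r := by
  filter_upwards [Real.tendsto_log_atTop.eventually (eventually_prod_logIter_le s hη),
    eventually_one_le_logIter (s + 1)] with r hr hl
  have hp : 0 < ∏ k ∈ Finset.range s, logIter (k + 1 + 1) r := Finset.prod_pos fun k hk => by
    linarith [hl (k + 1 + 1) (by have := Finset.mem_range.1 hk; omega)]
  have h1 : 0 < logIter 1 r := by linarith [hl 1 (by omega)]
  have hr' : ∏ k ∈ Finset.range s, logIter (k + 1 + 1) r ≤ η * logIter 1 r := hr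
  rw [Finset.prod_div_distrib, Finset.prod_const_one, Finset.prod_range_succ', mul_one_div,
    one_div_pow, div_le_div_iff₀ (by positivity) (by positivity)]
  rw [zero_add]
  nlinarith

/-- The quadratic corrections are eventually absorbed by the last term of the potential. -/
theorem exists_logWeight_absorbed (s : ℕ) {ε₀ : ℝ} (h₀ : 0 < ε₀) : ∃ ε : ℝ, 0 < ε ∧ ∀ C : ℝ,
    ∀ᶠ r in atTop, logWeight s ε (fun k => 1 / logIter k r) ^ 2 / 4
        + 8 * ((s ^ 2 + ε * s) * (1 / logIter 1 r) ^ 2) + C / r ^ 2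
      ≤ (ε₀ - 2 * ε) * ∏ k ∈ Finset.range s, 1 / logIter (k + 1) r := by
  -- The loss 2ε takes at most half of ε₀; one quarter pays for C/r² and one for the quadratic
  -- errors. ε ≤ 1 keeps the constant D free of ε, and gives ε² ≤ ε when s = 0.
  set ε := min (ε₀ / 4) 1 with hε
  have hε0 : 0 < ε := lt_min (by linarith) one_pos
  have hε1 : ε ≤ 1 := min_le_right _ _
  have hε4 : ε ≤ ε₀ / 4 := min_le_left _ _
  refine ⟨ε, hε0, fun C => ?_⟩
  have hC : ∀ᶠ r in atTop, C / r ^ 2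
      ≤ ε₀ / 4 * ∏ k ∈ Finset.range s, 1 / logIter (k + 1) r := by
    have hη : 0 < ε₀ / 4 / (|C| + 1) := by positivity
    filter_upwards [eventually_inv_sq_le s hη, eventually_one_le_logIter s] with r hr hl
    set P := ∏ k ∈ Finset.range s, 1 / logIter (k + 1) r with hP
    have h2 := mul_le_mul_of_nonneg_left hr (by positivity : (0 : ℝ) ≤ |C| + 1)
    have h3 : (|C| + 1) * (ε₀ / 4 / (|C| + 1) * P) = ε₀ / 4 * P := by
      field_simp
    rw [h3] at h2
    refine le_trans ?_ h2
    rw [div_eq_mul_one_div]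
    exact mul_le_mul_of_nonneg_right (by linarith [le_abs_self C]) (by positivity)
  cases s with
  | zero =>
    filter_upwards [hC] with r hr
    simp [logWeight] at hr ⊢
    nlinarith
  | succ s =>
    set D : ℝ := ((s + 1 : ℕ) + 2 : ℝ) ^ 2 / 4 + 8 * (((s + 1 : ℕ) : ℝ) ^ 2 + (s + 1 : ℕ)) with hD
    have hD0 : 0 < D := by positivity
    have hη : 0 < ε₀ / 4 / D := by positivity
    filter_upwards [hC, eventually_inv_log_sq_le s hη, eventually_one_le_logIter (s + 1)]
      with r hr hr2 hl
    set α : ℕ → ℝ := fun k => 1 / logIter k r with hα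
    have hα1 : ∀ k < s + 1, 0 ≤ α (k + 1) ∧ α (k + 1) ≤ 1 := fun k hk => by
      have := hl (k + 1) (by omega)
      exact ⟨by simp only [hα]; positivity, by
        simp only [hα]; rw [div_le_one (by linarith)]; exact this⟩
    set P := ∏ k ∈ Finset.range (s + 1), 1 / logIter (k + 1) r with hP
    have hP' : ∏ k ∈ Finset.range (s + 1), α (k + 1) = P := rfl
    have hα0 : 0 ≤ α 1 := (hα1 0 (by omega)).1
    have hPα : P ≤ α 1 := prod_range_succ_le hα1
    have hP0 : 0 ≤ P := (prod_range_mem_Icc hα1).1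
    have hW0 : 0 ≤ logWeight (s + 1) ε α := by
      rw [logWeight, hP']
      refine add_nonneg (Finset.sum_nonneg fun i hi => ?_) (by positivity)
      exact (prod_range_mem_Icc fun k hk => hα1 k (by have := Finset.mem_range.1 hi; omega)).1
    have hW : logWeight (s + 1) ε α ≤ ((s + 1 : ℕ) + 2 : ℝ) * α 1 := by
      have h1 : ∑ i ∈ Finset.range (s + 1), ∏ k ∈ Finset.range (i + 1), α (k + 1)
          ≤ (s + 1 : ℕ) * α 1 := by
        refine (Finset.sum_le_card_nsmul _ _ (α 1) fun i hi => ?_).trans (le_of_eq ?_)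
        · exact prod_range_succ_le fun k hk => hα1 k (by have := Finset.mem_range.1 hi; omega)
        · rw [Finset.card_range, nsmul_eq_mul]
      have h2 : ε * P ≤ 1 * α 1 := mul_le_mul hε1 hPα hP0 zero_le_one
      rw [logWeight, hP', add_mul]
      linarith
    have hW2 := pow_le_pow_left₀ hW0 hW 2
    have h3 := mul_le_mul_of_nonneg_left hr2 hD0.le
    have h4 : D * (ε₀ / 4 / D * P) = ε₀ / 4 * P := by field_simp
    rw [h4] at h3
    have h5 : (1 / logIter 1 r) ^ 2 = α 1 ^ 2 := rfl
    rw [h5] at h3 ⊢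
    have h6 : D * α 1 ^ 2 = (((s + 1 : ℕ) + 2 : ℝ) * α 1) ^ 2 / 4
        + 8 * ((((s + 1 : ℕ) : ℝ) ^ 2 + (s + 1 : ℕ)) * α 1 ^ 2) := by rw [hD]; ring
    have h7 : ε * ((s + 1 : ℕ) * α 1 ^ 2) ≤ 1 * ((s + 1 : ℕ) * α 1 ^ 2) :=
      mul_le_mul_of_nonneg_right hε1 (by positivity)
    have h8 : ε * P ≤ ε₀ / 4 * P := mul_le_mul_of_nonneg_right hε4 hP0
    linarith

theorem sum_prod_Icc_eq (s : ℕ) (f : ℕ → ℝ) : ∑ j ∈ Finset.Icc 1 s, ∏ k ∈ Finset.Icc 1 j, f k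
    = ∑ i ∈ Finset.range s, ∏ k ∈ Finset.range (i + 1), f (k + 1) := by
  rw [← Finset.Ico_add_one_right_eq_Icc, Finset.sum_Ico_eq_sum_range]
  simp [prod_Icc_one_eq, add_comm]

/-- The explicit decay condition implies the comparison condition. -/
theorem exists_comparison_of_le {s : ℕ} {ε₀ : ℝ} (h₀ : 0 < ε₀) : ∃ ε : ℝ, 0 < ε ∧ ∃ N : ℝ,
    ∀ n : Lattice d, N ≤ latNorm n →
      -((d : ℝ) * (4 - (d : ℝ)) / (4 * latNorm n ^ 2))
          - 1 / latNorm n ^ 2 *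
              ∑ j ∈ Finset.Icc 1 s, ∏ k ∈ Finset.Icc 1 j, 1 / logIter k (latNorm n)
          - ε₀ / latNorm n ^ 2 * ∏ k ∈ Finset.Icc 1 s, 1 / logIter k (latNorm n)
        ≤ 2 * (d : ℝ) - ∑ j : Fin d, comparisonTerm s ε n (n + basisVec j)
          - ∑ j : Fin d, comparisonTerm s ε n (n - basisVec j) := by
  obtain ⟨ε, hε, habs⟩ := exists_logWeight_absorbed s h₀
  obtain ⟨M, hM, hjet⟩ := hasJet_comparison d s hε
  obtain ⟨R, hR1, hR⟩ := exists_one_le_logIter s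
  obtain ⟨N, hN⟩ := eventually_atTop.1 (habs (190 * d * M))
  -- 3M brings the increments into the range of the jets; R + 1 keeps the iterated logarithms at
  -- least 1 at the neighbours too.
  refine ⟨ε, hε, max N (max (3 * M) (R + 1)), fun n hn => ?_⟩
  obtain ⟨hn1, hn2⟩ := max_le_iff.1 hn
  obtain ⟨hn2, hn3⟩ := max_le_iff.1 hn2
  have hbig := hN _ hn1
  set r := latNorm n with hr
  have hr0 : 0 < r := by linarith
  set α : ℕ → ℝ := fun k => 1 / logIter k r with hα
  have hl := hR r (by linarith)
  have hα1 : ∀ k < s, 0 ≤ α (k + 1) ∧ α (k + 1) ≤ 1 := fun k hk => by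
    have := hl (k + 1) (by omega)
    exact ⟨by simp only [hα]; positivity, by
      simp only [hα]; rw [div_le_one (by linarith)]; exact this⟩
  obtain ⟨e, he, hj⟩ := hjet α hα1
  set E : ℝ → ℝ := fun x => Real.exp (-1 * logComparison d s ε α x) - 1 with hE
  have hsum := sum_jet_le hj hM n hn2
  rw [← hr] at hsum
  have hplus : ∀ j, comparisonTerm s ε n (n + basisVec j) = 1 + E ((1 + 2 * n j) / r ^ 2) := by
    intro j
    rw [comparisonTerm_eq_exp hl (hR _ (by linarith [sub_one_le_latNorm_add n j]))
      (δ := (1 + 2 * n j) / r ^ 2) (by rw [latNorm_add_basisVec_sq, ← hr]; field_simp; ring)]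
    simp only [hE, ← hr, ← hα]
    ring
  have hminus : ∀ j, comparisonTerm s ε n (n - basisVec j) = 1 + E ((1 - 2 * n j) / r ^ 2) := by
    intro j
    rw [comparisonTerm_eq_exp hl (hR _ (by linarith [sub_one_le_latNorm_sub n j]))
      (δ := (1 - 2 * n j) / r ^ 2) (by rw [latNorm_sub_basisVec_sq, ← hr]; field_simp; ring)]
    simp only [hE, ← hr, ← hα]
    ring
  simp only [hplus, hminus, Finset.sum_add_distrib, Finset.sum_const, Finset.card_univ,
    Fintype.card_fin, nsmul_eq_mul, mul_one] at hsum ⊢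
  rw [sum_prod_Icc_eq, prod_Icc_one_eq]
  set P := ∏ k ∈ Finset.range s, 1 / logIter (k + 1) r with hP
  set S := ∑ i ∈ Finset.range s, ∏ k ∈ Finset.range (i + 1), 1 / logIter (k + 1) r with hS
  have hW : logWeight s ε α = S + 2 * ε * P := rfl
  set W := logWeight s ε α with hWdef
  have ht : 0 < r ^ 2 := by positivity
  have h1 : (1 / logIter 1 r) = α 1 := rfl
  rw [h1] at hbig
  -- The cross terms in d W cancel between the linear and quadratic coefficients, leaving d(4-d)/4 +
  -- W + W²/4 + 8e; this is the source of the constant d(4-d)/4.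
  have h2 : (2 * (d : ℝ) * (-(d + W) / 4) + 8 * ((d + W) / 8 + (d + W) ^ 2 / 32 + e))
      + 190 * d * M / r ^ 2 ≤ d * (4 - d) / 4 + S + ε₀ * P := by
    have h3 := (abs_le.1 he).2
    have h4 : (2 * (d : ℝ) * (-(d + W) / 4) + 8 * ((d + W) / 8 + (d + W) ^ 2 / 32 + e))
        = d * (4 - d) / 4 + W + W ^ 2 / 4 + 8 * e := by ring
    rw [h4]
    linarith
  have h5 := div_le_div_of_nonneg_right h2 ht.le
  have h6 : (2 * (d : ℝ) * (-(d + W) / 4) + 8 * ((d + W) / 8 + (d + W) ^ 2 / 32 + e)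
      + 190 * d * M / r ^ 2) / r ^ 2
      = (2 * (d : ℝ) * (-(d + W) / 4) + 8 * ((d + W) / 8 + (d + W) ^ 2 / 32 + e)) / r ^ 2
        + 190 * d * M / (r ^ 2) ^ 2 := by
    rw [add_div, div_div, ← sq]
  have h7 : (d * (4 - d) / 4 + S + ε₀ * P) / r ^ 2
      = (d : ℝ) * (4 - d) / (4 * r ^ 2) + 1 / r ^ 2 * S + ε₀ / r ^ 2 * P := by
    field_simp
  rw [h6, h7] at h5
  linarith

end DiscreteSchrodinger

/-! ### The theorem -/

theorem theorem3p5 (d : ℕ) (hd : 1 ≤ d) (V : DiscreteSchrodinger.Lattice d → ℝ)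
    (hsup : IsLUB (DiscreteSchrodinger.realPoints
      (DiscreteSchrodinger.spec (DiscreteSchrodinger.schrodinger V))) (4 * (d : ℝ)))
    (hess : IsLUB (DiscreteSchrodinger.realPoints
      (DiscreteSchrodinger.essSpec (DiscreteSchrodinger.schrodinger V))) (4 * (d : ℝ)))
    (hcrit : DiscreteSchrodinger.IsCriticalFromAbove V (4 * (d : ℝ))) :
    ((∃ (s : ℕ) (ε : ℝ), 0 < ε ∧ ∃ N : ℝ, ∀ n : DiscreteSchrodinger.Lattice d,
        N ≤ DiscreteSchrodinger.latNorm n →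
        V n ≤ 2 * (d : ℝ)
          - ∑ j : Fin d, DiscreteSchrodinger.comparisonTerm s ε n
              (n + DiscreteSchrodinger.basisVec j)
          - ∑ j : Fin d, DiscreteSchrodinger.comparisonTerm s ε n
              (n - DiscreteSchrodinger.basisVec j)) →
      ((4 * (d : ℝ) : ℝ) : ℂ) ∈
        DiscreteSchrodinger.pointSpec (DiscreteSchrodinger.schrodinger V)) ∧
    ((∃ (s : ℕ) (ε : ℝ), 0 < ε ∧ ∃ N : ℝ, ∀ n : DiscreteSchrodinger.Lattice d,
        N ≤ DiscreteSchrodinger.latNorm n →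
        V n ≤ -((d : ℝ) * (4 - (d : ℝ)) / (4 * DiscreteSchrodinger.latNorm n ^ 2))
          - 1 / DiscreteSchrodinger.latNorm n ^ 2 *
              ∑ j ∈ Finset.Icc 1 s, ∏ k ∈ Finset.Icc 1 j,
                1 / DiscreteSchrodinger.logIter k (DiscreteSchrodinger.latNorm n)
          - ε / DiscreteSchrodinger.latNorm n ^ 2 *
              ∏ k ∈ Finset.Icc 1 s,
                1 / DiscreteSchrodinger.logIter k (DiscreteSchrodinger.latNorm n)) →
      ((4 * (d : ℝ) : ℝ) : ℂ) ∈
        DiscreteSchrodinger.pointSpec (DiscreteSchrodinger.schrodinger V)) := by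
  refine ⟨?_, ?_⟩
  · rintro ⟨s, ε, hε, N, h⟩
    exact DiscreteSchrodinger.mem_pointSpec_of_le_comparisonTerm hd hcrit hε h
  · rintro ⟨s, ε₀, h₀, N, h⟩
    obtain ⟨ε, hε, N', hN'⟩ := DiscreteSchrodinger.exists_comparison_of_le (d := d) (s := s) h₀
    refine DiscreteSchrodinger.mem_pointSpec_of_le_comparisonTerm hd hcrit hε
      (s := s) (N := max N N') fun n hn => ?_
    exact (h n ((le_max_left _ _).trans hn)).trans (hN' n ((le_max_right _ _).trans hn))
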